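/- Use coordinates $\mathbb C\times\mathbb R$ on Euclidean 3-space. For an integer $n\ge 5$, $h>0$ and $\rho\in\mathbb R$ put $P_k=(e^{2\pi i k/n},0)$, $Q_k^\rho=(e^{2\pi i\rho+2\pi i k/n},h)$, and let $$A_n^\rho=\bigcup_{k=0}^{n-1}\triangle P_kP_{k+1}Q_{k+1}^\rho\cup\triangle Q_{k+1}^\rho Q_k^\rho P_k ,$$ with boundary $\partial A_n^\rho$ the union of the two closed polygonal lines $P_0\cdots P_n$ and $Q_0^\rho\cdots Q_n^\rho$. Call $(n,\ell,h,\rho,\sigma)$ admissible if $n\ge5$, $h>0$, $\ell\in\{2,\dots,n-3\}$ and either $$\sigma=\rho+\tfrac{\ell}{n},\quad -\tfrac12<\rho<-\tfrac{\ell}{2n}-\tfrac1n,\qquad\text{or}\qquad \sigma=\rho-\tfrac{\ell}{n},\quad \tfrac{\ell}{2n}<\rho<\tfrac12-\tfrac1n .$$ An origami embedding of a flat torus $\mathbb C/\Lambda$ is a topological embedding into Euclidean 3-space that is isometric on each of finitely many nondegenerate plane triangles whose images cover $\mathbb C/\Lambda$. For $\operatorname{Im}\tau>0$, the surface $A_n^\rho\cup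 A_n^\sigma$ is said to be an origami-embedded flat torus of modulus $\tau$ if it is the image of an origami embedding of $\mathbb C/\omega(\mathbb Z+\mathbb Z\tau)$ for some $\omega\in\mathbb C\setminus\{0\}$, where the orientation is the one for which, in the development of the surface into $\mathbb C$, the annulus $A_n^\rho$ lies to the left of the edge from $P_0$ to $P_1$. Theorem. (1) For all admissible $(n,\ell,h,\rho,\sigma)$ one has $\partial A_n^\rho=\partial A_n^\sigma=A_n^\rho\cap A_n^\sigma$, and $A_n^\rho\cup A_n^\sigma$ is an origami-embedded flat torus (of some modulus). (2) For every $\tau$ in the upper half plane whose $SL_2(\mathbb Z)$-orbit contains no pure imaginary number, there are admissible $(n,\ell,h,\rho,\sigma)$ such that $A_n^\rho\cup A_n^\sigma$ is an origami-embedded flat torus of modulus $\tau$. -/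

import Mathlib

open scoped MatrixGroups

noncomputable section

namespace OrigamiTorus

/-- Euclidean 3-space, with coordinates in `ℂ × ℝ` and the Euclidean (`L²`) distance. -/
abbrev E3 : Type := WithLp 2 (ℂ × ℝ)

/-- The vertex `P_k = (e^{2πik/n}, 0)` of the lower regular `n`-gon. -/
def vertexP (n k : ℕ) : E3 :=
  WithLp.toLp 2 (Complex.exp (2 * Real.pi * Complex.I * ((k : ℂ) / (n : ℂ))), 0)

/-- The vertex `Q_k^ρ = (e^{2πiρ + 2πik/n}, h)` of the upper regular `n`-gon. -/
def vertexQ (n : ℕ) (h ρ : ℝ) (k : ℕ) : E3 :=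
  WithLp.toLp 2 (Complex.exp (2 * Real.pi * Complex.I * ((ρ : ℂ) + (k : ℂ) / (n : ℂ))), h)

/-- The closed (filled) triangle with vertices `a`, `b`, `c`. -/
def triangle (a b c : E3) : Set E3 := convexHull ℝ {a, b, c}

/-- The polyhedral surface `A_n^ρ` of height `h`: the union of the `2n` triangles
`P_k P_{k+1} Q_{k+1}^ρ` and `Q_{k+1}^ρ Q_k^ρ P_k`, `k = 0, …, n - 1`. -/
def annulus (n : ℕ) (h ρ : ℝ) : Set E3 :=
  ⋃ k ∈ Finset.range n,
    triangle (vertexP n k) (vertexP n (k + 1)) (vertexQ n h ρ (k + 1)) ∪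
      triangle (vertexQ n h ρ (k + 1)) (vertexQ n h ρ k) (vertexP n k)

/-- The boundary of `A_n^ρ`: the lower polygon `P_0 ⋯ P_n` and the upper polygon
`Q_0^ρ ⋯ Q_n^ρ` (closed polygonal lines, not filled). -/
def annulusBoundary (n : ℕ) (h ρ : ℝ) : Set E3 :=
  ⋃ k ∈ Finset.range n,
    segment ℝ (vertexP n k) (vertexP n (k + 1)) ∪
      segment ℝ (vertexQ n h ρ k) (vertexQ n h ρ (k + 1))

/-- The parameters of the construction: `n ≥ 5`, `h > 0`, `ℓ ∈ {2, …, n - 3}`, and either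
`σ = ρ + ℓ/n` with `-1/2 < ρ < -ℓ/(2n) - 1/n`, or
`σ = ρ - ℓ/n` with `ℓ/(2n) < ρ < 1/2 - 1/n`. -/
structure Admissible (n ℓ : ℕ) (h ρ σ : ℝ) : Prop where
  five_le : 5 ≤ n
  height_pos : 0 < h
  two_le : 2 ≤ ℓ
  le_sub : ℓ + 3 ≤ n
  range :
    (σ = ρ + (ℓ : ℝ) / n ∧ -(1 / 2) < ρ ∧ ρ < -((ℓ : ℝ) / (2 * n)) - 1 / n) ∨
      (σ = ρ - (ℓ : ℝ) / n ∧ (ℓ : ℝ) / (2 * n) < ρ ∧ ρ < 1 / 2 - 1 / n)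

/-- The lattice `ω (ℤ + ℤ τ)` in `ℂ`. For `ω ≠ 0`, the quotient `ℂ ⧸ torusLattice ω τ` is a flat
torus of modulus `τ`, and every flat torus of modulus `τ` is of this form. -/
def torusLattice (ω : ℂ) (τ : UpperHalfPlane) : AddSubgroup ℂ :=
  AddSubgroup.closure {ω, ω * (τ : ℂ)}

/-- `f` is an origami embedding of the flat torus `ℂ ⧸ Λ` in Euclidean 3-space: a topological
embedding such that the torus is covered by the images of finitely many nondegenerate closed
triangles of the plane on each of which `f` is isometric (hence an affine isometry). -/
structure IsOrigamiEmbedding (Λ : AddSubgroup ℂ) (f : ℂ ⧸ Λ → E3) : Prop where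
  isEmbedding : Topology.IsEmbedding f
  piecewise_isometric : ∃ (N : ℕ) (v : Fin N → Fin 3 → ℂ),
    (∀ i, AffineIndependent ℝ (v i)) ∧
    (∀ x : ℂ ⧸ Λ, ∃ i, ∃ z ∈ convexHull ℝ (Set.range (v i)), (z : ℂ ⧸ Λ) = x) ∧
    (∀ i, ∀ z ∈ convexHull ℝ (Set.range (v i)), ∀ w ∈ convexHull ℝ (Set.range (v i)),
      dist (f (z : ℂ ⧸ Λ)) (f (w : ℂ ⧸ Λ)) = dist z w)

/-- The orientation convention which distinguishes the modulus `τ` from that of the mirror image: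
in a development of the surface into the oriented plane `ℂ`, the annulus `A_n^ρ` lies on the left
of the edge running from `P_0` to `P_1`. Here `u` is the unit direction of the developed edge. -/
def InnerOnLeft (n : ℕ) (h ρ : ℝ) (Λ : AddSubgroup ℂ) (f : ℂ ⧸ Λ → E3) : Prop :=
  ∃ (z u : ℂ) (ε : ℝ), ‖u‖ = 1 ∧ 0 < ε ∧
    ∀ s ∈ Set.Icc (0 : ℝ) 1,
      f ((z + (s * dist (vertexP n 0) (vertexP n 1) : ℝ) * u : ℂ) : ℂ ⧸ Λ) =
        AffineMap.lineMap (vertexP n 0) (vertexP n 1) s ∧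
      ∀ t ∈ Set.Icc (0 : ℝ) ε,
        f ((z + ((s * dist (vertexP n 0) (vertexP n 1) : ℝ) + t * Complex.I) * u : ℂ) : ℂ ⧸ Λ) ∈
          annulus n h ρ

/-- The surface `A_n^ρ ∪ A_n^σ` is an origami-embedded flat torus of modulus `τ`. -/
def IsOrigamiTorusOfModulus (n : ℕ) (h ρ σ : ℝ) (τ : UpperHalfPlane) : Prop :=
  ∃ ω : ℂ, ω ≠ 0 ∧ ∃ f : ℂ ⧸ torusLattice ω τ → E3,
    IsOrigamiEmbedding (torusLattice ω τ) f ∧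
    Set.range f = annulus n h ρ ∪ annulus n h σ ∧
    InnerOnLeft n h ρ (torusLattice ω τ) f

end OrigamiTorus

end

/-! Embeddedness. At relative height `v` with `0 < v < 1`, a slice of an annulus consists of points
`(1 - v) p + v e^{2πiρ} q`, where `p` and `q` lie on the regular `n`-gon and one of them rests at a
vertex while the other runs through an adjacent edge (`slice_eq_stair`). If two slice points
coincide, the chords `c₁` between the `p`'s and `c₂` between the `q`'s satisfy, after removal of
common factors, `(1 - v) c₁ + v e^{iA} c₂ = 0` with `A = 2πρ + πL/n`, so `e^{iA} c₂ c̄₁` is real and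
nonpositive. On the other hand `c₂ c̄₁` lies, up to sign, in the sector of angles `0` to `2π/n`
(`chord_product`). Admissibility puts this sector, turned by `A`, into one open half plane bounded
by the real axis, so both chords vanish; comparing positions on the polygon then gives `L ≡ 0, ±1`
mod `n`, which is excluded (`slice_ne`). Within one annulus `L = 0`, the sign is always positive,
and it suffices that the turned sector misses the negative real ray (`slice_injective`).

Flatness. Each annulus develops onto a straight strip modulo a translation by `n * side n`. Put the
two strips on the two sides of the real axis; the outer edges are glued by `translation`. The
resulting doubly periodic `fold` is continuous, isometric on triangles, and injective modulo
`periods` by the slice results; compactness of the quotient makes it an embedding.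

Moduli. The real part of the modulus depends only on `n`, `L` and `ρ`, and the imaginary part is the
sum of the strip widths over `n * side n`. Move `τ` to the fundamental domain. A nonzero real part
of size at most `1/2` is attained for large `n` because it is attained in the limit `ℓ / n → t`
(`exists_angle`); the height then adjusts the imaginary part by the intermediate value theorem
(`exists_height`). -/

noncomputable section

namespace OrigamiTorus

open Real ComplexConjugate Filter Topology

/-! ### Chords of the regular polygon. -/

/-- The complex number of modulus one and argument `x`. -/
def cis (x : ℝ) : ℂ := Complex.exp (x * Complex.I)

lemma cis_add (x y : ℝ) : cis (x + y) = cis x * cis y := by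
  simp [cis, add_mul, Complex.exp_add]

@[simp] lemma cis_re (x : ℝ) : (cis x).re = cos x := Complex.exp_ofReal_mul_I_re x

@[simp] lemma cis_im (x : ℝ) : (cis x).im = sin x := Complex.exp_ofReal_mul_I_im x

@[simp] lemma cis_zero : cis 0 = 1 := by simp [cis]

lemma cis_ne_zero (x : ℝ) : cis x ≠ 0 := Complex.exp_ne_zero _

lemma cis_mul_conj (x : ℝ) : cis x * conj (cis x) = 1 := by
  rw [Complex.mul_conj, Complex.normSq_apply]
  norm_cast
  simp only [cis_re, cis_im]
  nlinarith [sin_sq_add_cos_sq x]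

@[simp] lemma norm_cis (x : ℝ) : ‖cis x‖ = 1 := Complex.norm_exp_ofReal_mul_I x

lemma cis_add_int_mul_two_pi (x : ℝ) (j : ℤ) : cis (x + j * (2 * π)) = cis x := by
  apply Complex.ext <;> simp [cos_add_int_mul_two_pi, sin_add_int_mul_two_pi]

lemma cis_sub_cis (x y : ℝ) :
    cis x - cis y = 2 * Complex.I * (sin ((x - y) / 2) : ℝ) * cis ((x + y) / 2) := by
  apply Complex.ext
  · simp [Real.cos_sub_cos, -Complex.ofReal_sin]; ring
  · simp [Real.sin_sub_sin, -Complex.ofReal_sin]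

/-- `sin (π d / n)`, half the length of the chord joining vertices of the regular `n`-gon at
distance `d`. -/
def chordSin (n : ℕ) (d : ℤ) : ℝ := sin (π * d / n)

/-- The point with parameter `t` on the `k`-th edge of the regular `n`-gon. -/
def edgePoint (n : ℕ) (k : ℤ) (t : ℝ) : ℂ :=
  (1 - t) * cis (2 * π * k / n) + t * cis (2 * π * (k + 1) / n)

lemma edgePoint_eq (n : ℕ) (k : ℤ) (t : ℝ) :
    edgePoint n k t = cis (2 * π * k / n) * (1 + t * (cis (2 * π / n) - 1)) := by
  have : cis (2 * π * (k + 1) / n) = cis (2 * π * k / n) * cis (2 * π / n) := by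
    rw [← cis_add]; congr 1; ring
  rw [edgePoint, this]; ring

lemma vertex_sub (n : ℕ) (a b : ℝ) :
    cis (2 * π * b / n) - cis (2 * π * a / n) =
      2 * Complex.I * (sin (π * (b - a) / n) : ℝ) * cis (π * (a + b) / n) := by
  rw [cis_sub_cis, show (2 * π * b / n - 2 * π * a / n) / 2 = π * (b - a) / n by ring,
    show (2 * π * b / n + 2 * π * a / n) / 2 = π * (a + b) / n by ring]

/-- Expand bilinearly into the four vertex chords. A vertex chord has the direction of the mean
angle of its ends, and the two mixed pairs of ends have the same mean angle, so only three
directions occur. -/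
lemma edgePoint_sub (n : ℕ) (k k' : ℤ) (t t' : ℝ) :
    edgePoint n k' t' - edgePoint n k t = 2 * Complex.I * cis (π * (k + k') / n) *
      (((1 - t) * (1 - t') * chordSin n (k' - k) : ℝ) +
        ((1 - t) * t' * chordSin n (k' - k + 1) + t * (1 - t') * chordSin n (k' - k - 1) : ℝ) *
          cis (π / n) + (t * t' * chordSin n (k' - k) : ℝ) * cis (2 * π / n)) := by
  have h00 := vertex_sub n k k'
  have h01 := vertex_sub n k (k' + 1)
  have h10 := vertex_sub n (k + 1) k'
  have h11 := vertex_sub n (k + 1) (k' + 1)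
  have e0 : cis (π * (k + (k' + 1)) / n) = cis (π * (k + k') / n) * cis (π / n) := by
    rw [← cis_add]; congr 1; ring
  have e1 : cis (π * (k + 1 + k') / n) = cis (π * (k + k') / n) * cis (π / n) := by
    rw [← cis_add]; congr 1; ring
  have e2 : cis (π * (k + 1 + (k' + 1)) / n) = cis (π * (k + k') / n) * cis (2 * π / n) := by
    rw [← cis_add]; congr 1; ring
  have s0 : sin (π * ((k' : ℝ) - k) / n) = chordSin n (k' - k) := by
    simp [chordSin]
  have s1 : sin (π * ((k' + 1 : ℝ) - k) / n) = chordSin n (k' - k + 1) := by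
    rw [chordSin]; push_cast; congr 2; ring
  have s2 : sin (π * ((k' : ℝ) - (k + 1)) / n) = chordSin n (k' - k - 1) := by
    rw [chordSin]; push_cast; congr 2; ring
  have s3 : sin (π * ((k' + 1 : ℝ) - (k + 1)) / n) = chordSin n (k' - k) := by
    rw [chordSin]; push_cast; congr 2; ring
  rw [s0] at h00; rw [s1, e0] at h01; rw [s2, e1] at h10; rw [s3, e2] at h11
  simp only [edgePoint]
  push_cast
  linear_combination (1 - t : ℂ) * (1 - t') * h00 + (1 - t : ℂ) * t' * h01 +
    (t : ℂ) * (1 - t') * h10 + (t : ℂ) * t' * h11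

/-- The sign is constant while `d` runs from one multiple of `n` to the next. Only at a multiple of
`n` do the two neighbours `d - 1` and `d + 1` lie in different intervals, whence the alternative. -/
lemma chordSin_signs {n : ℕ} (hn : 0 < n) (d : ℤ) :
    ∃ ε : ℝ, (ε = 1 ∨ ε = -1) ∧ 0 ≤ ε * chordSin n d ∧ 0 ≤ ε * chordSin n (d + 1) ∧
      (chordSin n d = 0 ∨ 0 ≤ ε * chordSin n (d - 1)) := by
  have hn' : (0 : ℝ) < n := by exact_mod_cast hn
  have hnz : (0 : ℤ) < n := by exact_mod_cast hn
  have hr0 := Int.emod_nonneg d hnz.ne'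
  have hr1 := Int.emod_lt_of_pos d hnz
  have hd := Int.mul_ediv_add_emod d n
  set q := d / (n : ℤ)
  set r := d % (n : ℤ)
  have key : ∀ j : ℤ, chordSin n (d + j) = (-1) ^ q * sin (π * (r + j) / n) := by
    intro j
    rw [← sin_add_int_mul_pi, chordSin, ← hd]
    congr 1
    push_cast
    field_simp
    ring
  have hsgn : ((-1 : ℝ) ^ q) = 1 ∨ ((-1 : ℝ) ^ q) = -1 := by
    rcases Int.even_or_odd q with h | h
    · left; exact h.neg_one_zpow
    · right; exact h.neg_one_zpow
  have hsq : ((-1 : ℝ) ^ q) * ((-1 : ℝ) ^ q) = 1 := by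
    rcases hsgn with h | h <;> rw [h] <;> norm_num
  have nonneg : ∀ j : ℤ, 0 ≤ r + j → r + j ≤ n →
      0 ≤ ((-1 : ℝ) ^ q) * chordSin n (d + j) := by
    intro j h0 h1
    rw [key, ← mul_assoc, hsq, one_mul]
    have h0' : (0 : ℝ) ≤ r + j := by exact_mod_cast h0
    have h1' : (r + j : ℝ) ≤ n := by exact_mod_cast h1
    apply sin_nonneg_of_nonneg_of_le_pi
    · positivity
    · rw [div_le_iff₀ hn']
      exact mul_le_mul_of_nonneg_left h1' pi_pos.le
  refine ⟨(-1) ^ q, hsgn, by simpa using nonneg 0 (by omega) (by omega),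
    nonneg 1 (by omega) (by omega), ?_⟩
  rcases eq_or_lt_of_le hr0 with h | h
  · left
    have := key 0
    rw [add_zero] at this
    rw [this, ← h]
    simp
  · right
    have := nonneg (-1) (by omega) (by omega)
    rwa [← sub_eq_add_neg] at this

lemma chordSin_mul_succ_nonneg {n : ℕ} (hn : 0 < n) (d : ℤ) :
    0 ≤ chordSin n d * chordSin n (d + 1) := by
  obtain ⟨ε, h | h, h0, h1, -⟩ := chordSin_signs hn d <;> subst h <;> nlinarith

/-- Three real numbers, none of which is of sign opposite to another. -/
def SameSign (x y z : ℝ) : Prop := (0 ≤ x ∧ 0 ≤ y ∧ 0 ≤ z) ∨ (x ≤ 0 ∧ y ≤ 0 ∧ z ≤ 0)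

lemma SameSign.mul {x y z : ℝ} (h : SameSign x y z) (w : ℝ) :
    SameSign (w * x) (w * y) (w * z) := by
  rcases h with ⟨h1, h2, h3⟩ | ⟨h1, h2, h3⟩ <;> rcases le_total 0 w with hw | hw
  · exact Or.inl ⟨by positivity, by positivity, by positivity⟩
  · exact Or.inr ⟨by nlinarith, by nlinarith, by nlinarith⟩
  · exact Or.inr ⟨by nlinarith, by nlinarith, by nlinarith⟩
  · exact Or.inl ⟨by nlinarith, by nlinarith, by nlinarith⟩

lemma SameSign.rev {x y z : ℝ} (h : SameSign x y z) : SameSign z y x := by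
  rcases h with ⟨h1, h2, h3⟩ | ⟨h1, h2, h3⟩
  · exact Or.inl ⟨h3, h2, h1⟩
  · exact Or.inr ⟨h3, h2, h1⟩

/-- In the exceptional case of `chordSin_signs` the outer coefficients vanish and the middle one may
have any sign. -/
lemma edge_coeff_sameSign {n : ℕ} (hn : 0 < n) (d : ℤ) {t t' : ℝ} (ht : t ∈ Set.Icc (0 : ℝ) 1)
    (ht' : t' ∈ Set.Icc (0 : ℝ) 1) :
    SameSign ((1 - t) * (1 - t') * chordSin n d)
      ((1 - t) * t' * chordSin n (d + 1) + t * (1 - t') * chordSin n (d - 1))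
      (t * t' * chordSin n d) := by
  obtain ⟨h0, h1⟩ := ht
  obtain ⟨h0', h1'⟩ := ht'
  have a := sub_nonneg.2 h1
  have a' := sub_nonneg.2 h1'
  have c1 := mul_nonneg a a'
  have c2 := mul_nonneg a h0'
  have c3 := mul_nonneg h0 a'
  have c4 := mul_nonneg h0 h0'
  obtain ⟨ε, h, hd, hs, hz | hp⟩ := chordSin_signs hn d
  · rw [hz, mul_zero, mul_zero]
    rcases le_total 0 ((1 - t) * t' * chordSin n (d + 1) + t * (1 - t') * chordSin n (d - 1)) with
      h | h
    · exact Or.inl ⟨le_rfl, h, le_rfl⟩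
    · exact Or.inr ⟨le_rfl, h, le_rfl⟩
  · have e1 := mul_nonneg c1 hd
    have e2 := mul_nonneg c2 hs
    have e3 := mul_nonneg c3 hp
    have e4 := mul_nonneg c4 hd
    rcases h with h | h <;> subst h
    · exact Or.inl ⟨by linarith, by linarith, by linarith⟩
    · exact Or.inr ⟨by linarith, by linarith, by linarith⟩


/-! ### Pairs of chords occurring in a slice. -/

/-- Pairs of points of the regular `n`-gon that occur together in a horizontal slice of an annulus:
one of the two points is a vertex, and the other runs through an adjacent edge. -/
def Stair (k₁ : ℤ) (t₁ : ℝ) (k₂ : ℤ) (t₂ : ℝ) : Prop :=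
  (k₂ = k₁ ∧ t₁ = 0 ∧ t₂ ∈ Set.Icc (0 : ℝ) 1) ∨ (k₂ = k₁ + 1 ∧ t₂ = 0 ∧ t₁ ∈ Set.Icc (0 : ℝ) 1)

lemma sameSign_of_mul_nonneg {a b c d p q p' q' : ℝ} (h : 0 ≤ a * b) (h' : 0 ≤ c * d)
    (hp : 0 ≤ p) (hq : 0 ≤ q) (hp' : 0 ≤ p') (hq' : 0 ≤ q') :
    SameSign (p * a * (p' * c)) (p * a * (q' * d) + q * b * (p' * c)) (q * b * (q' * d)) := by
  rcases mul_nonneg_iff.1 h with ⟨h1, h2⟩ | ⟨h1, h2⟩ <;> rcases mul_nonneg_iff.1 h' with ⟨h3, h4⟩ | ⟨h3, h4⟩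
  · exact Or.inl ⟨by positivity, by positivity, by positivity⟩
  · right
    have e1 := mul_nonpos_of_nonneg_of_nonpos (mul_nonneg hp h1)
      (mul_nonpos_of_nonneg_of_nonpos hp' h3)
    have e2 := mul_nonpos_of_nonneg_of_nonpos (mul_nonneg hp h1)
      (mul_nonpos_of_nonneg_of_nonpos hq' h4)
    have e3 := mul_nonpos_of_nonneg_of_nonpos (mul_nonneg hq h2)
      (mul_nonpos_of_nonneg_of_nonpos hp' h3)
    have e4 := mul_nonpos_of_nonneg_of_nonpos (mul_nonneg hq h2)
      (mul_nonpos_of_nonneg_of_nonpos hq' h4)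
    exact ⟨e1, by linarith, e4⟩
  · right
    have e1 := mul_nonpos_of_nonpos_of_nonneg (mul_nonpos_of_nonneg_of_nonpos hp h1)
      (mul_nonneg hp' h3)
    have e2 := mul_nonpos_of_nonpos_of_nonneg (mul_nonpos_of_nonneg_of_nonpos hp h1)
      (mul_nonneg hq' h4)
    have e3 := mul_nonpos_of_nonpos_of_nonneg (mul_nonpos_of_nonneg_of_nonpos hq h2)
      (mul_nonneg hp' h3)
    have e4 := mul_nonpos_of_nonpos_of_nonneg (mul_nonpos_of_nonneg_of_nonpos hq h2)
      (mul_nonneg hq' h4)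
    exact ⟨e1, by linarith, e4⟩
  · left
    have e1 := mul_nonneg_of_nonpos_of_nonpos (mul_nonpos_of_nonneg_of_nonpos hp h1)
      (mul_nonpos_of_nonneg_of_nonpos hp' h3)
    have e2 := mul_nonneg_of_nonpos_of_nonpos (mul_nonpos_of_nonneg_of_nonpos hp h1)
      (mul_nonpos_of_nonneg_of_nonpos hq' h4)
    have e3 := mul_nonneg_of_nonpos_of_nonpos (mul_nonpos_of_nonneg_of_nonpos hq h2)
      (mul_nonpos_of_nonneg_of_nonpos hp' h3)
    have e4 := mul_nonneg_of_nonpos_of_nonpos (mul_nonpos_of_nonneg_of_nonpos hq h2)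
      (mul_nonpos_of_nonneg_of_nonpos hq' h4)
    exact ⟨e1, by linarith, e4⟩

lemma cone_mul_conj {ξ : ℂ} (hξ : ξ * conj ξ = 1) (a₀ a₁ b₁ b₂ : ℝ) :
    (b₁ * ξ + b₂ * (ξ * ξ)) * conj (a₀ + a₁ * ξ) =
      (a₁ * b₁ : ℝ) + (a₁ * b₂ + a₀ * b₁ : ℝ) * ξ + (a₀ * b₂ : ℝ) * (ξ * ξ) := by
  simp only [map_add, map_mul, Complex.conj_ofReal]
  push_cast
  linear_combination (b₁ * a₁ + b₂ * a₁ * ξ : ℂ) * hξ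

lemma cone_mul_conj' {ξ : ℂ} (hξ : ξ * conj ξ = 1) (w x y z : ℝ) :
    w * (ξ * ξ) * conj (x + y * ξ + z * (ξ * ξ)) =
      (w * z : ℝ) + (w * y : ℝ) * ξ + (w * x : ℝ) * (ξ * ξ) := by
  simp only [map_add, map_mul, Complex.conj_ofReal]
  push_cast
  linear_combination (w * y * ξ + w * z * (ξ * conj ξ + 1) : ℂ) * hξ

/-- Chords have their directions in a narrow double sector, and in general a product of two would
spread over twice the angle. The `Stair` condition prevents this: the factors have one and three
terms, or two and two, so only three consecutive powers of `cis (π / n)` appear. For `L = 0` the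
coefficients are squares or products of adjacent values of `chordSin`, hence nonnegative. -/
lemma chord_product {n : ℕ} (hn : 0 < n) {k₁ k₂ k₁' k₂' : ℤ} {t₁ t₂ t₁' t₂' : ℝ}
    (h : Stair k₁ t₁ k₂ t₂) (h' : Stair k₁' t₁' k₂' t₂') (L : ℤ) :
    ∃ (c₁ c₂ : ℂ) (x y z : ℝ),
      edgePoint n k₁' t₁' - edgePoint n k₁ t₁ =
        2 * Complex.I * cis (π * (k₁ + k₁') / n) * c₁ ∧
      edgePoint n (k₂' + L) t₂' - edgePoint n k₂ t₂ =
        2 * Complex.I * cis (π * (k₁ + k₁') / n) * cis (π * L / n) * c₂ ∧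
      c₂ * conj c₁ = x + y * cis (π / n) + z * cis (2 * π / n) ∧
      SameSign x y z ∧ (L = 0 → 0 ≤ x ∧ 0 ≤ y ∧ 0 ≤ z) := by
  have hξ := cis_mul_conj (π / n)
  have hξ2 : cis (2 * π / n) = cis (π / n) * cis (π / n) := by
    rw [← cis_add]; congr 1; ring
  have mn := chordSin_mul_succ_nonneg hn
  set μ : ℝ := π * (k₁ + k₁') / n with hμ
  have shift0 : cis (π * (k₁ + (k₁' + L)) / n) = cis μ * cis (π * L / n) := by
    rw [← cis_add]; congr 1; ring
  have shift1 : cis (π * (k₁ + (k₁' + L + 1)) / n) =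
      cis μ * cis (π * L / n) * cis (π / n) := by
    rw [← cis_add, ← cis_add]; congr 1; ring
  have shift1' : cis (π * (k₁ + 1 + (k₁' + L)) / n) =
      cis μ * cis (π * L / n) * cis (π / n) := by
    rw [← cis_add, ← cis_add]; congr 1; ring
  have shift2 : cis (π * (k₁ + 1 + (k₁' + L + 1)) / n) =
      cis μ * cis (π * L / n) * (cis (π / n) * cis (π / n)) := by
    rw [← cis_add, ← cis_add, ← cis_add]; congr 1; ring
  have e1 := edgePoint_sub n k₁ k₁' t₁ t₁'
  have e2 := edgePoint_sub n k₂ (k₂' + L) t₂ t₂'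
  have sq := fun d => mul_self_nonneg (chordSin n d)
  have mp : ∀ d, 0 ≤ chordSin n d * chordSin n (d - 1) := by
    intro d
    have := mn (d - 1)
    rwa [sub_add_cancel, mul_comm] at this
  rw [hξ2] at e1 e2 ⊢
  set ξ := cis (π / n)
  set d := k₁' - k₁ with hd
  rcases h with ⟨rfl, rfl, hb, ha⟩ | ⟨rfl, rfl, hb, ha⟩ <;>
    rcases h' with ⟨rfl, rfl, hb', ha'⟩ | ⟨rfl, rfl, hb', ha'⟩
  -- Both lower points are vertices: `c₁` is real and `c₂` has three terms.
  · rw [show k₂' + L - k₂ = d + L by omega] at e2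
    push_cast at e2
    rw [shift0] at e2
    have a := sub_nonneg.2 ha
    have a' := sub_nonneg.2 ha'
    refine ⟨chordSin n d, _, _, _, _, e1.trans ?_, e2.trans (by rw [← mul_assoc]), ?_,
      (edge_coeff_sameSign hn (d + L) ⟨hb, ha⟩ ⟨hb', ha'⟩).mul (chordSin n d), ?_⟩
    · simp [hμ]
    · simp only [Complex.conj_ofReal]
      push_cast
      ring
    · rintro rfl
      rw [add_zero]
      refine ⟨?_, ?_, ?_⟩
      · linarith [mul_nonneg (mul_nonneg a a') (sq d)]
      · linarith [mul_nonneg (mul_nonneg a hb') (mn d), mul_nonneg (mul_nonneg hb a') (mp d)]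
      · linarith [mul_nonneg (mul_nonneg hb hb') (sq d)]
  · rw [show k₁' + 1 + L = k₁' + L + 1 by ring] at e2 ⊢
    rw [show k₁' + L + 1 - k₂ = d + L + 1 by omega] at e2
    push_cast at e2
    rw [shift1, show d + L + 1 - 1 = d + L by ring] at e2
    have a := sub_nonneg.2 ha
    have a' := sub_nonneg.2 ha'
    refine ⟨((1 - t₁') * chordSin n d : ℝ) + (t₁' * chordSin n (d + 1) : ℝ) * ξ,
      ((1 - t₂) * chordSin n (d + L + 1) : ℝ) * ξ + (t₂ * chordSin n (d + L) : ℝ) * (ξ * ξ),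
      _, _, _, e1.trans ?_, e2.trans ?_, cone_mul_conj hξ _ _ _ _,
      sameSign_of_mul_nonneg ((mn d).trans_eq (mul_comm _ _)) ((mn (d + L)).trans_eq (mul_comm _ _))
        hb' a' a hb, ?_⟩
    · push_cast; ring
    · push_cast; ring
    · rintro rfl
      rw [add_zero]
      refine ⟨?_, ?_, ?_⟩
      · linarith [mul_nonneg (mul_nonneg hb' a) (sq (d + 1))]
      · linarith [mul_nonneg (mul_nonneg hb' hb) (mn d), mul_nonneg (mul_nonneg a' a) (mn d)]
      · linarith [mul_nonneg (mul_nonneg a' hb) (sq d)]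
  · rw [show k₂' + L - (k₁ + 1) = d + L - 1 by omega] at e2
    push_cast at e2
    rw [shift1', show d + L - 1 + 1 = d + L by ring] at e2
    have a := sub_nonneg.2 ha
    have a' := sub_nonneg.2 ha'
    refine ⟨((1 - t₁) * chordSin n d : ℝ) + (t₁ * chordSin n (d - 1) : ℝ) * ξ,
      ((1 - t₂') * chordSin n (d + L - 1) : ℝ) * ξ + (t₂' * chordSin n (d + L) : ℝ) * (ξ * ξ),
      _, _, _, e1.trans ?_, e2.trans ?_, cone_mul_conj hξ _ _ _ _,
      sameSign_of_mul_nonneg ((mp d).trans_eq (mul_comm _ _)) ((mp (d + L)).trans_eq (mul_comm _ _))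
        hb a a' hb', ?_⟩
    · push_cast; ring
    · push_cast; ring
    · rintro rfl
      rw [add_zero]
      refine ⟨?_, ?_, ?_⟩
      · linarith [mul_nonneg (mul_nonneg hb a') (sq (d - 1))]
      · linarith [mul_nonneg (mul_nonneg hb hb') (mp d), mul_nonneg (mul_nonneg a a') (mp d)]
      · linarith [mul_nonneg (mul_nonneg a hb') (sq d)]
  -- Both upper points are vertices: `c₂` has one term, and conjugation reverses the three
  -- coefficients of `c₁`.
  · rw [show k₁' + 1 + L = k₁' + L + 1 by ring] at e2 ⊢
    rw [show k₁' + L + 1 - (k₁ + 1) = d + L by omega] at e2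
    push_cast at e2
    rw [shift2] at e2
    have a := sub_nonneg.2 ha
    have a' := sub_nonneg.2 ha'
    refine ⟨_, chordSin n (d + L) * (ξ * ξ), _, _, _, e1, e2.trans ?_,
      cone_mul_conj' hξ _ _ _ _,
      ((edge_coeff_sameSign hn d ⟨hb, ha⟩ ⟨hb', ha'⟩).mul (chordSin n (d + L))).rev, ?_⟩
    · ring
    · rintro rfl
      rw [add_zero]
      refine ⟨?_, ?_, ?_⟩
      · linarith [mul_nonneg (mul_nonneg hb hb') (sq d)]
      · linarith [mul_nonneg (mul_nonneg a hb') (mn d), mul_nonneg (mul_nonneg hb a') (mp d)]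
      · linarith [mul_nonneg (mul_nonneg a a') (sq d)]

/-! ### Sectors and the real axis. -/

/-- The directions of angles `A`, `A + π / n` and `A + 2 π / n` lie strictly on the same side of the
real axis. -/
def AvoidsReal (n : ℕ) (A : ℝ) : Prop :=
  (0 < sin A ∧ 0 < sin (A + π / n) ∧ 0 < sin (A + 2 * π / n)) ∨
    (sin A < 0 ∧ sin (A + π / n) < 0 ∧ sin (A + 2 * π / n) < 0)

lemma eq_zero_of_sum_eq_zero {a b c x y z : ℝ} (ha : 0 < a) (hb : 0 < b) (hc : 0 < c)
    (h : SameSign x y z) (hs : x * a + y * b + z * c = 0) : x = 0 ∧ y = 0 ∧ z = 0 := by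
  rcases h with ⟨h1, h2, h3⟩ | ⟨h1, h2, h3⟩
  · have e1 := mul_nonneg h1 ha.le
    have e2 := mul_nonneg h2 hb.le
    have e3 := mul_nonneg h3 hc.le
    refine ⟨?_, ?_, ?_⟩
    · exact (mul_eq_zero.1 (by linarith : x * a = 0)).resolve_right ha.ne'
    · exact (mul_eq_zero.1 (by linarith : y * b = 0)).resolve_right hb.ne'
    · exact (mul_eq_zero.1 (by linarith : z * c = 0)).resolve_right hc.ne'
  · have e1 := mul_nonneg (neg_nonneg.2 h1) ha.le
    have e2 := mul_nonneg (neg_nonneg.2 h2) hb.le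
    have e3 := mul_nonneg (neg_nonneg.2 h3) hc.le
    refine ⟨?_, ?_, ?_⟩
    · exact (mul_eq_zero.1 (by linarith : x * a = 0)).resolve_right ha.ne'
    · exact (mul_eq_zero.1 (by linarith : y * b = 0)).resolve_right hb.ne'
    · exact (mul_eq_zero.1 (by linarith : z * c = 0)).resolve_right hc.ne'

lemma cone_eq_zero_of_avoidsReal {n : ℕ} {A x y z r : ℝ} (hA : AvoidsReal n A)
    (h : SameSign x y z)
    (hr : cis A * (x + y * cis (π / n) + z * cis (2 * π / n)) = r) :
    x = 0 ∧ y = 0 ∧ z = 0 := by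
  have e : cis A * (x + y * cis (π / n) + z * cis (2 * π / n)) =
      x * cis A + y * cis (A + π / n) + z * cis (A + 2 * π / n) := by
    rw [cis_add, cis_add]; ring
  rw [e] at hr
  have him := congrArg Complex.im hr
  simp at him
  rcases hA with ⟨h1, h2, h3⟩ | ⟨h1, h2, h3⟩
  · exact eq_zero_of_sum_eq_zero h1 h2 h3 h him
  · exact eq_zero_of_sum_eq_zero (neg_pos.2 h1) (neg_pos.2 h2) (neg_pos.2 h3) h (by linarith)

/-- The sector from `A` to `A + 2π/n` misses the negative real ray, and a line through the origin
separates the two. -/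
lemma cone_eq_zero_of_lt_pi {n : ℕ} (hn : 3 ≤ n) {A x y z r : ℝ} (hA : -π < A)
    (hA' : A + 2 * π / n < π) (hx : 0 ≤ x) (hy : 0 ≤ y) (hz : 0 ≤ z) (hr0 : 0 ≤ r)
    (hr : cis A * (x + y * cis (π / n) + z * cis (2 * π / n)) = -r) :
    x = 0 ∧ y = 0 ∧ z = 0 := by
  have hn' : (3 : ℝ) ≤ n := by exact_mod_cast hn
  set δ := π / n with hδ
  have hδ2 : 2 * π / n = 2 * δ := by rw [hδ]; ring
  rw [hδ2] at hA' hr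
  have hδ0 : 0 < δ := by positivity
  have hδ1 : δ ≤ π / 3 := div_le_div_of_nonneg_left pi_pos.le (by norm_num) hn'
  obtain ⟨γ, hγ1, hγ2, hγ3, hγ4⟩ : ∃ γ : ℝ, -(π / 2) ≤ γ ∧ γ ≤ π / 2 ∧ -(π / 2) < A - γ ∧
      A + 2 * δ - γ < π / 2 := by
    have hπδ : 0 < π - δ := by linarith
    set q := (A + δ) / (π - δ) with hq
    have hq1 : -1 < q := by rw [hq, lt_div_iff₀ hπδ]; linarith
    have hq2 : q < 1 := by rw [hq, div_lt_iff₀ hπδ]; linarith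
    have hqe : A + δ = q * (π - δ) := by rw [hq, div_mul_cancel₀ _ hπδ.ne']
    -- The central angle `A + δ` lies in the interval from `-(π - δ)` to `π - δ`; rescaling that
    -- interval to `-π/2` to `π/2` gives a direction `γ` within a right angle both of the positive
    -- real axis and of the whole sector.
    exact ⟨q * (π / 2), by nlinarith, by nlinarith, by nlinarith, by nlinarith⟩
  have e : cis A * (x + y * cis δ + z * cis (2 * δ)) * cis (-γ) =
      x * cis (A - γ) + y * cis (A + δ - γ) + z * cis (A + 2 * δ - γ) := by
    simp only [sub_eq_add_neg, cis_add]; ring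
  rw [hr] at e
  have hre := congrArg Complex.re e
  simp at hre
  have c0 : 0 ≤ cos γ := cos_nonneg_of_mem_Icc ⟨hγ1, hγ2⟩
  have c1 : 0 < cos (A - γ) := cos_pos_of_mem_Ioo ⟨by linarith, by linarith⟩
  have c2 : 0 < cos (A + δ - γ) := cos_pos_of_mem_Ioo ⟨by linarith, by linarith⟩
  have c3 : 0 < cos (A + 2 * δ - γ) := cos_pos_of_mem_Ioo ⟨by linarith, by linarith⟩
  have := mul_nonneg hr0 c0
  have := mul_nonneg hx c1.le
  have := mul_nonneg hy c2.le
  have := mul_nonneg hz c3.le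
  exact eq_zero_of_sum_eq_zero c1 c2 c3 (Or.inl ⟨hx, hy, hz⟩) (by linarith)

/-- The rotation numbers for which the horizontal slices of the annulus are simple polygons. -/
def IsTwist (n : ℕ) (ρ : ℝ) : Prop := -(1 / 2) < ρ ∧ ρ < 1 / 2 - 1 / n

/-- Multiplying the relation by `conj c₁` turns it into a statement about the direction of a single
product. -/
lemma mul_conj_add_eq {v : ℝ} (A : ℝ) {c₁ c₂ W : ℂ} (hv0 : 0 < v)
    (h : (1 - v) * c₁ + v * cis A * c₂ = 0) (hW : c₂ * conj c₁ = W) :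
    cis A * W = -(((1 - v) / v * Complex.normSq c₁ : ℝ) : ℂ) := by
  have hv : (v : ℂ) ≠ 0 := by exact_mod_cast hv0.ne'
  rw [← hW, Complex.ofReal_mul, ← Complex.mul_conj]
  push_cast
  field_simp
  linear_combination conj c₁ * h

lemma both_eq_zero {v : ℝ} {A : ℝ} {c₁ c₂ : ℂ} (hv0 : 0 < v) (hv1 : v < 1)
    (h : (1 - v) * c₁ + v * cis A * c₂ = 0) (hW : c₂ * conj c₁ = 0) : c₁ = 0 ∧ c₂ = 0 := by
  have hv : (v : ℂ) ≠ 0 := by exact_mod_cast hv0.ne'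
  have hv' : (1 - v : ℂ) ≠ 0 := by exact_mod_cast (sub_pos.2 hv1).ne'
  rcases mul_eq_zero.1 hW with hc | hc
  · rw [hc] at h
    exact ⟨by simpa [hv'] using h, hc⟩
  · have hc : c₁ = 0 := by simpa using hc
    rw [hc] at h
    exact ⟨hc, by simpa [hv, cis_ne_zero] using h⟩

/-- The heart of the embedding argument: a coincidence of convex combinations forces the coincidence
of both constituents. `L = 0` serves for one annulus, the other alternative for two different ones.
-/
lemma stair_points_eq {n : ℕ} (hn : 3 ≤ n) {ρ v : ℝ} (hv0 : 0 < v) (hv1 : v < 1) {L : ℤ}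
    (hρ : AvoidsReal n (2 * π * ρ + π * L / n) ∨ L = 0 ∧ IsTwist n ρ)
    {k₁ k₂ k₁' k₂' : ℤ} {t₁ t₂ t₁' t₂' : ℝ}
    (h : Stair k₁ t₁ k₂ t₂) (h' : Stair k₁' t₁' k₂' t₂')
    (heq : (1 - v) * edgePoint n k₁ t₁ + v * cis (2 * π * ρ) * edgePoint n k₂ t₂ =
      (1 - v) * edgePoint n k₁' t₁' + v * cis (2 * π * ρ) * edgePoint n (k₂' + L) t₂') :
    edgePoint n k₁ t₁ = edgePoint n k₁' t₁' ∧ edgePoint n k₂ t₂ = edgePoint n (k₂' + L) t₂' := by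
  obtain ⟨c₁, c₂, x, y, z, h1, h2, hW, hs, hpos⟩ := chord_product (by omega : 0 < n) h h' L
  set μ := cis (π * (k₁ + k₁') / n) with hμ
  have hμ0 : 2 * Complex.I * μ ≠ 0 := by simp [hμ, cis_ne_zero]
  have hc : (1 - v) * c₁ + v * cis (2 * π * ρ + π * L / n) * c₂ = 0 := by
    apply mul_left_cancel₀ hμ0
    rw [cis_add]
    linear_combination -heq - (1 - v : ℂ) * h1 - v * cis (2 * π * ρ) * h2
  have hr := mul_conj_add_eq _ hv0 hc hW
  have hr0 : 0 ≤ (1 - v) / v * Complex.normSq c₁ :=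
    mul_nonneg (div_nonneg (by linarith) hv0.le) (Complex.normSq_nonneg _)
  have hxyz : x = 0 ∧ y = 0 ∧ z = 0 := by
    rcases hρ with hρ | ⟨rfl, hρ⟩
    · exact cone_eq_zero_of_avoidsReal hρ hs (by rw [hr, ← Complex.ofReal_neg])
    · obtain ⟨hx, hy, hz⟩ := hpos rfl
      obtain ⟨r1, r2⟩ := hρ
      refine cone_eq_zero_of_lt_pi hn ?_ ?_ hx hy hz hr0 hr
      · have := pi_pos
        simp
        nlinarith
      · have := mul_lt_mul_of_pos_left r2 two_pi_pos
        have e : 2 * π * (1 / 2 - 1 / n) = π - 2 * π / n := by ring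
        rw [e] at this
        simp
        linarith
  obtain ⟨rfl, rfl, rfl⟩ := hxyz
  obtain ⟨rfl, rfl⟩ := both_eq_zero hv0 hv1 hc (by simpa using hW)
  rw [mul_zero, sub_eq_zero] at h1 h2
  exact ⟨h1.symm, h2.symm⟩

lemma chordSin_eq_zero {n : ℕ} (hn : 0 < n) {d : ℤ} (h : chordSin n d = 0) : ∃ j : ℤ, d = n * j := by
  obtain ⟨j, hj⟩ := sin_eq_zero_iff.1 h
  refine ⟨j, ?_⟩
  have hn' : (n : ℝ) ≠ 0 := by positivity
  have := pi_ne_zero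
  field_simp at hj
  rw [mul_comm] at hj
  exact_mod_cast hj.symm

lemma chordSin_one_pos {n : ℕ} (hn : 2 ≤ n) : 0 < chordSin n 1 := by
  have hn' : (2 : ℝ) ≤ n := by exact_mod_cast hn
  apply sin_pos_of_pos_of_lt_pi
  · simp; positivity
  · rw [div_lt_iff₀ (by positivity)]
    simp
    nlinarith [pi_pos]

lemma cone_coeff_eq_zero {n : ℕ} (hn : 3 ≤ n) {x y z : ℝ} (hs : SameSign x y z)
    (h : x + y * cis (π / n) + z * cis (2 * π / n) = 0) : x = 0 ∧ y = 0 ∧ z = 0 := by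
  have hn' : (3 : ℝ) ≤ n := by exact_mod_cast hn
  have h3 : 2 * π / n < π := by
    rw [div_lt_iff₀ (by positivity)]
    nlinarith [pi_pos]
  have hπ := two_pi_pos
  have h0 : 0 < 2 * π / n := by positivity
  have e1 : π / n = 2 * π / n / 2 := by ring
  -- This `A` centres the sector at the angle `π / 2`.
  refine cone_eq_zero_of_avoidsReal (n := n) (A := (π - 2 * π / n) / 2) (r := 0) (Or.inl ⟨?_, ?_, ?_⟩) hs
    (by rw [h]; simp)
  all_goals
    apply sin_pos_of_pos_of_lt_pi <;> linarith

lemma edgePoint_injective {n : ℕ} (hn : 3 ≤ n) {k k' : ℤ} {t t' : ℝ} (ht : t ∈ Set.Icc (0 : ℝ) 1)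
    (ht' : t' ∈ Set.Icc (0 : ℝ) 1) (h : edgePoint n k t = edgePoint n k' t') :
    ∃ j : ℤ, k' + t' = k + t + n * j := by
  have hn0 : 0 < n := by omega
  have e := edgePoint_sub n k k' t t'
  rw [h, sub_self] at e
  have hμ0 : 2 * Complex.I * cis (π * (k + k') / n) ≠ 0 := by simp [cis_ne_zero]
  obtain ⟨h1, h2, h3⟩ := cone_coeff_eq_zero hn (edge_coeff_sameSign hn0 (k' - k) ht ht')
    ((mul_eq_zero.1 e.symm).resolve_left hμ0)
  have hS := chordSin_one_pos (by omega : 2 ≤ n)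
  by_cases hd : chordSin n (k' - k) = 0
  · obtain ⟨j, hj⟩ := chordSin_eq_zero hn0 hd
    refine ⟨j, ?_⟩
    have key : ∀ i : ℤ, chordSin n (k' - k + i) = (-1) ^ j * chordSin n i := by
      intro i
      have hn' : (n : ℝ) ≠ 0 := by positivity
      rw [hj, chordSin, chordSin, ← sin_add_int_mul_pi]
      congr 1
      push_cast
      field_simp
      ring
    have hneg : chordSin n (-1) = - chordSin n 1 := by
      simp [chordSin, ← sin_neg, neg_div]
    rw [key 1, sub_eq_add_neg (k' - k) 1, key (-1), hneg] at h2
    have h0 : ((-1) ^ j * chordSin n 1) * (t' - t) = 0 := by linear_combination h2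
    have : t' - t = 0 := (mul_eq_zero.1 h0).resolve_left
      (mul_ne_zero (zpow_ne_zero _ (by norm_num)) hS.ne')
    have hj' : (k' : ℝ) - k = n * j := by exact_mod_cast hj
    linarith
  · have h1 : (1 - t) * (1 - t') = 0 := (mul_eq_zero.1 h1).resolve_right hd
    have h3 : t * t' = 0 := (mul_eq_zero.1 h3).resolve_right hd
    rcases mul_eq_zero.1 h3 with rfl | rfl
    · have ht : t' = 1 := by linarith
      subst ht
      obtain ⟨j, hj⟩ := chordSin_eq_zero hn0 (d := k' - k + 1) (by simpa using h2)
      have hj' : (k' : ℝ) - k + 1 = n * j := by exact_mod_cast hj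
      exact ⟨j, by linarith⟩
    · have ht : t = 1 := by linarith
      subst ht
      obtain ⟨j, hj⟩ := chordSin_eq_zero hn0 (d := k' - k - 1) (by simpa using h2)
      have hj' : (k' : ℝ) - k - 1 = n * j := by exact_mod_cast hj
      exact ⟨j, by linarith⟩

/-! ### Horizontal slices as closed polygons. -/

/-- The horizontal section of an annulus over one period, before rotation. -/
def cell (n : ℕ) (ρ t v : ℝ) : ℂ :=
  (1 - v) + v * cis (2 * π * ρ) +
    ((min t v : ℝ) * cis (2 * π * ρ) + (max (t - v) 0 : ℝ)) * (cis (2 * π / n) - 1)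

/-- The horizontal section of an annulus at relative height `v`, as a closed polygonal line which is
parametrised with period `n`. -/
def slice (n : ℕ) (ρ s v : ℝ) : ℂ := cis (2 * π * ⌊s⌋ / n) * cell n ρ (Int.fract s) v

lemma cell_one {n : ℕ} {ρ v : ℝ} (hv : v ∈ Set.Icc (0 : ℝ) 1) :
    cell n ρ 1 v = cis (2 * π / n) * cell n ρ 0 v := by
  have e1 := min_eq_right hv.2
  have e2 := max_eq_left (sub_nonneg.2 hv.2)
  have e3 := min_eq_left hv.1
  have e4 : max (0 - v) 0 = 0 := max_eq_right (by linarith [hv.1])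
  rw [cell, cell, e1, e2, e3, e4]
  push_cast
  ring

lemma slice_eq {n : ℕ} {ρ s v : ℝ} {k : ℤ} (hv : v ∈ Set.Icc (0 : ℝ) 1) (h0 : k ≤ s)
    (h1 : s ≤ k + 1) : slice n ρ s v = cis (2 * π * k / n) * cell n ρ (s - k) v := by
  rcases h1.lt_or_eq with h | h
  · have hk : ⌊s⌋ = k := Int.floor_eq_iff.2 ⟨h0, h⟩
    rw [slice, Int.fract, hk]
  · subst h
    have hk : ⌊(k + 1 : ℝ)⌋ = k + 1 := by
      rw [← Int.cast_one, ← Int.cast_add, Int.floor_intCast]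
    rw [slice, Int.fract, hk]
    push_cast
    rw [sub_self, add_sub_cancel_left, cell_one hv, ← mul_assoc, ← cis_add]
    congr 2
    ring

lemma slice_add_period {n : ℕ} (hn : 0 < n) (ρ s v : ℝ) (j : ℤ) :
    slice n ρ (s + n * j) v = slice n ρ s v := by
  have e : s + n * j = s + ((n * j : ℤ) : ℝ) := by push_cast; rfl
  have hn' : (n : ℝ) ≠ 0 := by positivity
  rw [slice, slice, e, Int.floor_add_intCast, Int.fract_add_intCast]
  congr 1
  rw [← cis_add_int_mul_two_pi (2 * π * ⌊s⌋ / n) j]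
  congr 1
  push_cast
  field_simp

lemma slice_zero {n : ℕ} {ρ s : ℝ} : slice n ρ s 0 = edgePoint n ⌊s⌋ (Int.fract s) := by
  have e3 := min_eq_right (Int.fract_nonneg s)
  have e4 := max_eq_left (Int.fract_nonneg s)
  rw [slice, cell, sub_zero, e3, e4, edgePoint_eq]
  push_cast
  ring

lemma slice_one {n : ℕ} {ρ s : ℝ} :
    slice n ρ s 1 = cis (2 * π * ρ) * edgePoint n ⌊s⌋ (Int.fract s) := by
  have h := (Int.fract_lt_one s).le
  have e3 := min_eq_left h
  have e4 := max_eq_right (sub_nonpos.2 h)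
  rw [slice, cell, e3, e4, edgePoint_eq]
  push_cast
  ring

lemma slice_eq_stair (n : ℕ) (ρ s : ℝ) {v : ℝ} (hv0 : 0 < v) (hv1 : v < 1) :
    ∃ (k₁ : ℤ) (t₁ : ℝ) (k₂ : ℤ) (t₂ : ℝ), Stair k₁ t₁ k₂ t₂ ∧
      slice n ρ s v = (1 - v) * edgePoint n k₁ t₁ + v * cis (2 * π * ρ) * edgePoint n k₂ t₂ ∧
      s = (1 - v) * (k₁ + t₁) + v * (k₂ + t₂) := by
  have hs := Int.floor_add_fract s
  have f0 := Int.fract_nonneg s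
  have f1 := Int.fract_lt_one s
  have hv : (v : ℂ) ≠ 0 := by exact_mod_cast hv0.ne'
  have hw0 := sub_pos.2 hv1
  have hv' : (1 - v : ℂ) ≠ 0 := by exact_mod_cast hw0.ne'
  rcases le_total (Int.fract s) v with h | h
  · refine ⟨⌊s⌋, 0, ⌊s⌋, Int.fract s / v, Or.inl ⟨rfl, rfl, by positivity, ?_⟩, ?_, ?_⟩
    · rwa [div_le_one hv0]
    · rw [slice, cell, min_eq_left h, max_eq_right (sub_nonpos.2 h), edgePoint_eq, edgePoint_eq]
      push_cast
      field_simp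
      ring
    · field_simp
      linarith
  · refine ⟨⌊s⌋, (Int.fract s - v) / (1 - v), ⌊s⌋ + 1, 0,
      Or.inr ⟨rfl, rfl, div_nonneg (sub_nonneg.2 h) hw0.le, ?_⟩, ?_, ?_⟩
    · rw [div_le_one hw0]; linarith
    · have e : cis (2 * π * ((⌊s⌋ + 1 : ℤ) : ℝ) / n) = cis (2 * π * ⌊s⌋ / n) * cis (2 * π / n) := by
        rw [← cis_add]; congr 1; push_cast; ring
      rw [slice, cell, min_eq_right h, max_eq_left (sub_nonneg.2 h), edgePoint_eq, edgePoint_eq, e]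
      push_cast
      field_simp
      ring
    · push_cast
      field_simp
      linarith

lemma Stair.bounds {k₁ k₂ : ℤ} {t₁ t₂ : ℝ} (h : Stair k₁ t₁ k₂ t₂) :
    t₁ ∈ Set.Icc (0 : ℝ) 1 ∧ t₂ ∈ Set.Icc (0 : ℝ) 1 ∧ (k₁ + t₁ : ℝ) ≤ k₂ + t₂ ∧
      (k₂ + t₂ : ℝ) ≤ k₁ + t₁ + 1 := by
  rcases h with ⟨rfl, rfl, h0, h1⟩ | ⟨rfl, rfl, h0, h1⟩
  · exact ⟨by simp, ⟨h0, h1⟩, by linarith, by linarith⟩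
  · exact ⟨⟨h0, h1⟩, by simp, by push_cast; linarith, by push_cast; linarith⟩

lemma fract_mem_Icc (s : ℝ) : Int.fract s ∈ Set.Icc (0 : ℝ) 1 :=
  ⟨Int.fract_nonneg s, (Int.fract_lt_one s).le⟩

lemma slice_injective {n : ℕ} (hn : 3 ≤ n) {ρ : ℝ} (hρ : IsTwist n ρ) {v : ℝ}
    (hv : v ∈ Set.Icc (0 : ℝ) 1) {s s' : ℝ} (h : slice n ρ s v = slice n ρ s' v) :
    ∃ j : ℤ, s' = s + n * j := by
  rcases hv.1.eq_or_lt with rfl | hv0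
  · rw [slice_zero, slice_zero] at h
    simpa using edgePoint_injective hn (fract_mem_Icc s) (fract_mem_Icc s') h
  rcases hv.2.eq_or_lt with rfl | hv1
  · rw [slice_one, slice_one] at h
    simpa using edgePoint_injective hn (fract_mem_Icc s) (fract_mem_Icc s')
      (mul_left_cancel₀ (cis_ne_zero _) h)
  obtain ⟨k₁, t₁, k₂, t₂, hst, e, hs⟩ := slice_eq_stair n ρ s hv0 hv1
  obtain ⟨k₁', t₁', k₂', t₂', hst', e', hs'⟩ := slice_eq_stair n ρ s' hv0 hv1
  rw [e, e'] at h
  obtain ⟨h1, h2⟩ := stair_points_eq hn hv0 hv1 (L := 0) (Or.inr ⟨rfl, hρ⟩) hst hst' (by simpa using h)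
  rw [add_zero] at h2
  obtain ⟨b1, b2, b3, b4⟩ := hst.bounds
  obtain ⟨b1', b2', b3', b4'⟩ := hst'.bounds
  obtain ⟨j₁, hj₁⟩ := edgePoint_injective hn b1 b1' h1
  obtain ⟨j₂, hj₂⟩ := edgePoint_injective hn b2 b2' h2
  have hn' : (3 : ℝ) ≤ n := by exact_mod_cast hn
  -- In either pair the upper position exceeds the lower by a number between 0 and 1, so `n |j₂ -
  -- j₁| ≤ 1 < n`.
  have hj : j₂ = j₁ := by
    have l1 : (n : ℝ) * (j₂ - j₁) < n * 1 := by linarith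
    have l2 : (n : ℝ) * (j₁ - j₂) < n * 1 := by linarith
    have l1 := lt_of_mul_lt_mul_left l1 (by positivity)
    have l2 := lt_of_mul_lt_mul_left l2 (by positivity)
    have l1 : j₂ - j₁ < 1 := by exact_mod_cast l1
    have l2 : j₁ - j₂ < 1 := by exact_mod_cast l2
    omega
  subst hj
  exact ⟨j₂, by rw [hs, hs', hj₁, hj₂]; ring⟩

lemma cis_mul_edgePoint {n : ℕ} (hn : 0 < n) (ρ : ℝ) (L k : ℤ) (t : ℝ) :
    cis (2 * π * (ρ + L / n)) * edgePoint n k t = cis (2 * π * ρ) * edgePoint n (k + L) t := by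
  have hn' : (n : ℝ) ≠ 0 := by positivity
  rw [edgePoint_eq, edgePoint_eq, ← mul_assoc, ← mul_assoc, ← cis_add, ← cis_add]
  congr 2
  push_cast
  field_simp
  ring

/-- At a common point the constituents agree modulo `n`, the upper ones with a shift by `L`. Since
an upper position leads its lower one by at most 1, `L` would be within 1 of a multiple of `n`. -/
lemma slice_ne {n : ℕ} (hn : 3 ≤ n) {ρ v s s' : ℝ} {L : ℤ}
    (hρ : AvoidsReal n (2 * π * ρ + π * L / n))
    (hL : ∀ i j : ℤ, L = n * j + i → 1 < |i|) (hv0 : 0 < v) (hv1 : v < 1) :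
    slice n ρ s v ≠ slice n (ρ + L / n) s' v := by
  intro h
  obtain ⟨k₁, t₁, k₂, t₂, hst, e, hs⟩ := slice_eq_stair n ρ s hv0 hv1
  obtain ⟨k₁', t₁', k₂', t₂', hst', e', hs'⟩ := slice_eq_stair n (ρ + L / n) s' hv0 hv1
  rw [mul_assoc (v : ℂ) _ (edgePoint n k₂' t₂'), cis_mul_edgePoint (by omega), ← mul_assoc] at e'
  rw [e, e'] at h
  obtain ⟨h1, h2⟩ := stair_points_eq hn hv0 hv1 (Or.inl hρ) hst hst' h
  obtain ⟨b1, b2, b3, b4⟩ := hst.bounds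
  obtain ⟨b1', b2', b3', b4'⟩ := hst'.bounds
  obtain ⟨j₁, hj₁⟩ := edgePoint_injective hn b1 b1' h1
  obtain ⟨j₂, hj₂⟩ := edgePoint_injective hn b2 b2' h2
  have := hL (L - n * (j₂ - j₁)) (j₂ - j₁) (by ring)
  push_cast at hj₂
  have l1 : (L : ℝ) - n * (j₂ - j₁) ≤ 1 := by linarith
  have l2 : -1 ≤ (L : ℝ) - n * (j₂ - j₁) := by linarith
  have l1 : L - n * (j₂ - j₁) ≤ 1 := by exact_mod_cast l1
  have l2 : -1 ≤ L - n * (j₂ - j₁) := by exact_mod_cast l2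
  exact absurd this (not_lt.2 (abs_le.2 ⟨l2, l1⟩))

lemma continuous_slice (n : ℕ) (ρ : ℝ) :
    Continuous fun x : ℝ × ℝ => slice n ρ x.1 (max 0 (min x.2 1)) := by
  -- With the rotation by the full parameter split off, the remaining factor depends on `s` only
  -- through its fractional part and has equal values at 0 and 1; this removes the jumps of the
  -- floor.
  have e : (fun x : ℝ × ℝ => slice n ρ x.1 (max 0 (min x.2 1))) = fun x =>
      cis (2 * π * x.1 / n) * (cis (-(2 * π * Int.fract x.1 / n)) *
        cell n ρ (Int.fract x.1) (max 0 (min x.2 1))) := by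
    funext x
    rw [slice, ← mul_assoc, ← cis_add]
    congr 2
    rw [← Int.self_sub_floor]
    ring
  have hc : Continuous cis := by unfold cis; fun_prop
  rw [e]
  refine (hc.comp (by fun_prop)).mul ?_
  have := ContinuousOn.comp_fract (s := fun x : ℝ × ℝ => x.1) (f := fun (x : ℝ × ℝ) (t : ℝ) =>
    cis (-(2 * π * t / n)) * cell n ρ t (max 0 (min x.2 1))) ?_ continuous_fst ?_
  · exact this
  · apply Continuous.continuousOn
    refine (hc.comp (by fun_prop)).mul ?_
    unfold cell
    fun_prop
  · intro x
    have hv : max 0 (min x.2 1) ∈ Set.Icc (0 : ℝ) 1 := ⟨le_max_left _ _, by simp⟩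
    rw [cell_one hv, ← mul_assoc, ← cis_add]
    congr 2
    ring

/-! ### Parametrising the annuli. -/

lemma mem_convexHull_triple {E : Type*} [AddCommGroup E] [Module ℝ E] {a b c x : E} :
    x ∈ convexHull ℝ {a, b, c} ↔
      ∃ p q r : ℝ, 0 ≤ p ∧ 0 ≤ q ∧ 0 ≤ r ∧ p + q + r = 1 ∧ p • a + q • b + r • c = x := by
  rw [convexHull_insert (by simp), convexHull_pair]
  simp only [convexJoin_singleton_left, Set.mem_iUnion]
  constructor
  · rintro ⟨y, ⟨q, r, hq, hr, hqr, rfl⟩, ⟨p, w, hp, hw, hpw, rfl⟩⟩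
    refine ⟨p, w * q, w * r, hp, by positivity, by positivity, ?_, ?_⟩
    · rw [add_assoc, ← mul_add, hqr, mul_one, hpw]
    · module
  · rintro ⟨p, q, r, hp, hq, hr, hs, rfl⟩
    rcases (add_nonneg hq hr).eq_or_lt with h | h
    · have hq0 : q = 0 := by linarith
      have hr0 : r = 0 := by linarith
      have hp1 : p = 1 := by linarith
      subst hq0 hr0 hp1
      exact ⟨b, left_mem_segment _ _ _, by simpa using left_mem_segment ℝ a b⟩
    · refine ⟨(q / (q + r)) • b + (r / (q + r)) • c, ⟨_, _, by positivity, by positivity, ?_, rfl⟩,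
        ⟨p, q + r, hp, h.le, by linarith, ?_⟩⟩
      · field_simp
      · rw [smul_add, smul_smul, smul_smul, mul_div_cancel₀ _ h.ne', mul_div_cancel₀ _ h.ne',
          add_assoc]

/-- The point of the annulus `A_n^ρ` with parameter `s` at relative height `v`. -/
def point (n : ℕ) (h ρ s v : ℝ) : E3 := WithLp.toLp 2 (slice n ρ s v, v * h)

lemma vertexP_eq (n k : ℕ) : vertexP n k = WithLp.toLp 2 (cis (2 * π * k / n), 0) := by
  rw [vertexP, cis]
  congr 3
  push_cast
  ring

lemma vertexQ_eq (n : ℕ) (h ρ : ℝ) (k : ℕ) :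
    vertexQ n h ρ k = WithLp.toLp 2 (cis (2 * π * ρ) * cis (2 * π * k / n), h) := by
  rw [vertexQ, ← cis_add, cis]
  congr 3
  push_cast
  ring

lemma cis_succ (n k : ℕ) :
    cis (2 * π * (k + 1 : ℕ) / n) = cis (2 * π * k / n) * cis (2 * π / n) := by
  rw [← cis_add]; congr 1; push_cast; ring

lemma point_eq {n : ℕ} {h ρ s v : ℝ} {k : ℕ} (hv : v ∈ Set.Icc (0 : ℝ) 1) (h0 : k ≤ s)
    (h1 : s ≤ k + 1) :
    point n h ρ s v = WithLp.toLp 2 (cis (2 * π * k / n) * cell n ρ (s - k) v, v * h) := by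
  rw [point, slice_eq (k := (k : ℤ)) hv (by exact_mod_cast h0) (by exact_mod_cast h1)]
  simp

lemma point_lower {n : ℕ} {h ρ t v : ℝ} {k : ℕ} (hv : 0 ≤ v) (hvt : v ≤ t) (ht : t ≤ 1) :
    point n h ρ (k + t) v = (1 - t) • vertexP n k + (t - v) • vertexP n (k + 1) +
      v • vertexQ n h ρ (k + 1) := by
  rw [point_eq (k := k) ⟨hv, hvt.trans ht⟩ (by linarith) (by linarith), vertexP_eq, vertexP_eq,
    vertexQ_eq, ← WithLp.toLp_smul, ← WithLp.toLp_smul, ← WithLp.toLp_smul, ← WithLp.toLp_add,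
    ← WithLp.toLp_add, cis_succ, add_sub_cancel_left, cell, min_eq_right hvt,
    max_eq_left (sub_nonneg.2 hvt)]
  congr 1
  ext1
  · simp
    ring
  · simp

lemma point_upper {n : ℕ} {h ρ t v : ℝ} {k : ℕ} (ht : 0 ≤ t) (hvt : t ≤ v) (hv : v ≤ 1) :
    point n h ρ (k + t) v = t • vertexQ n h ρ (k + 1) + (v - t) • vertexQ n h ρ k +
      (1 - v) • vertexP n k := by
  rw [point_eq (k := k) ⟨ht.trans hvt, hv⟩ (by linarith) (by linarith), vertexP_eq, vertexQ_eq,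
    vertexQ_eq, ← WithLp.toLp_smul, ← WithLp.toLp_smul, ← WithLp.toLp_smul, ← WithLp.toLp_add,
    ← WithLp.toLp_add, cis_succ, add_sub_cancel_left, cell, min_eq_left hvt,
    max_eq_right (sub_nonpos.2 hvt)]
  congr 1
  ext1
  · simp
    ring
  · simp
    ring

lemma point_add_period {n : ℕ} (hn : 0 < n) (h ρ s v : ℝ) (j : ℤ) :
    point n h ρ (s + n * j) v = point n h ρ s v := by
  rw [point, point, slice_add_period hn]

lemma exists_fundamental_param {n : ℕ} (hn : 0 < n) (s : ℝ) :
    ∃ (k : ℕ) (t : ℝ) (j : ℤ), k < n ∧ t ∈ Set.Icc (0 : ℝ) 1 ∧ s = k + t + n * j := by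
  have hnz : (0 : ℤ) < n := by exact_mod_cast hn
  have h0 := Int.emod_nonneg ⌊s⌋ hnz.ne'
  have h1 := Int.emod_lt_of_pos ⌊s⌋ hnz
  have h2 := Int.mul_ediv_add_emod ⌊s⌋ n
  obtain ⟨k, hk⟩ := Int.eq_ofNat_of_zero_le h0
  refine ⟨k, Int.fract s, ⌊s⌋ / n, by omega, fract_mem_Icc s, ?_⟩
  rw [hk] at h2
  have h2' : (n : ℝ) * (⌊s⌋ / (n : ℤ) : ℤ) + k = ⌊s⌋ := by exact_mod_cast h2
  linarith [Int.floor_add_fract s]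

lemma mem_annulus {n : ℕ} (hn : 0 < n) {h ρ : ℝ} {x : E3} :
    x ∈ annulus n h ρ ↔ ∃ s, ∃ v ∈ Set.Icc (0 : ℝ) 1, point n h ρ s v = x := by
  simp only [annulus, triangle, Set.mem_iUnion, Set.mem_union, mem_convexHull_triple,
    Finset.mem_range]
  constructor
  · rintro ⟨k, hk, ⟨p, q, r, hp, hq, hr, hs, rfl⟩ | ⟨p, q, r, hp, hq, hr, hs, rfl⟩⟩
    · refine ⟨k + (q + r), r, ⟨hr, by linarith⟩, ?_⟩
      rw [point_lower hr (by linarith) (by linarith), show 1 - (q + r) = p by linarith,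
        add_sub_cancel_right]
    · refine ⟨k + p, p + q, ⟨by linarith, by linarith⟩, ?_⟩
      rw [point_upper hp (by linarith) (by linarith), show 1 - (p + q) = r by linarith,
        add_sub_cancel_left]
  · rintro ⟨s, v, ⟨hv0, hv1⟩, rfl⟩
    obtain ⟨k, t, j, hk, ⟨ht0, ht1⟩, rfl⟩ := exists_fundamental_param hn s
    refine ⟨k, hk, ?_⟩
    rw [point_add_period hn]
    rcases le_total v t with hvt | hvt
    · exact Or.inl ⟨_, _, _, by linarith, by linarith, hv0, by ring,
        (point_lower hv0 hvt ht1).symm⟩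
    · exact Or.inr ⟨_, _, _, ht0, by linarith, by linarith, by ring,
        (point_upper ht0 hvt hv1).symm⟩

lemma mem_annulusBoundary {n : ℕ} (hn : 0 < n) {h ρ : ℝ} {x : E3} :
    x ∈ annulusBoundary n h ρ ↔ ∃ s, point n h ρ s 0 = x ∨ point n h ρ s 1 = x := by
  simp only [annulusBoundary, Set.mem_iUnion, Set.mem_union, Finset.mem_range]
  constructor
  · rintro ⟨k, hk, ⟨p, q, hp, hq, hs, rfl⟩ | ⟨p, q, hp, hq, hs, rfl⟩⟩
    · refine ⟨k + q, Or.inl ?_⟩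
      rw [point_lower le_rfl hq (by linarith), show 1 - q = p by linarith]
      simp
    · refine ⟨k + q, Or.inr ?_⟩
      rw [point_upper hq (by linarith) le_rfl, show 1 - q = p by linarith]
      simp [add_comm]
  · rintro ⟨s, rfl | rfl⟩ <;> obtain ⟨k, t, j, hk, ⟨ht0, ht1⟩, rfl⟩ := exists_fundamental_param hn s
    · refine ⟨k, hk, Or.inl ⟨1 - t, t, by linarith, ht0, by ring, ?_⟩⟩
      rw [point_add_period hn, point_lower le_rfl ht0 ht1]
      simp
    · refine ⟨k, hk, Or.inr ⟨1 - t, t, by linarith, ht0, by ring, ?_⟩⟩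
      rw [point_add_period hn, point_upper ht0 ht1 le_rfl]
      simp [add_comm]

lemma edgePoint_floor_add {n : ℕ} (s : ℝ) (L : ℤ) :
    edgePoint n ⌊s + L⌋ (Int.fract (s + L)) = edgePoint n (⌊s⌋ + L) (Int.fract s) := by
  rw [Int.floor_add_intCast, Int.fract_add_intCast]

lemma point_zero (n : ℕ) (h ρ σ s : ℝ) : point n h ρ s 0 = point n h σ s 0 := by
  rw [point, point, slice_zero, slice_zero]

/-- Turning the upper polygon by `L / n` permutes its vertices, so the two annuli share it with
parameters shifted by `L`. This shift enters the lattice. -/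
lemma point_one {n : ℕ} (hn : 0 < n) (h ρ s : ℝ) (L : ℤ) :
    point n h (ρ + L / n) s 1 = point n h ρ (s + L) 1 := by
  rw [point, point, slice_one, slice_one, cis_mul_edgePoint hn, edgePoint_floor_add]

lemma annulusBoundary_add {n : ℕ} (hn : 0 < n) (h ρ : ℝ) (L : ℤ) :
    annulusBoundary n h ρ = annulusBoundary n h (ρ + L / n) := by
  ext x
  rw [mem_annulusBoundary hn, mem_annulusBoundary hn]
  constructor
  · rintro ⟨s, rfl | rfl⟩
    · exact ⟨s, Or.inl (point_zero _ _ _ _ _)⟩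
    · exact ⟨s - L, Or.inr (by rw [point_one hn, sub_add_cancel])⟩
  · rintro ⟨s, rfl | rfl⟩
    · exact ⟨s, Or.inl (point_zero _ _ _ _ _)⟩
    · exact ⟨s + L, Or.inr (by rw [point_one hn])⟩

/-! ### The two annuli meet only in their boundary. -/

lemma point_eq_iff {n : ℕ} {h ρ σ s s' v v' : ℝ} (hh : 0 < h) :
    point n h ρ s v = point n h σ s' v' ↔ v = v' ∧ slice n ρ s v = slice n σ s' v := by
  rw [point, point, (WithLp.toLp_injective 2).eq_iff, Prod.mk.injEq, mul_left_inj' hh.ne']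
  constructor
  · rintro ⟨h1, rfl⟩; exact ⟨rfl, h1⟩
  · rintro ⟨rfl, h1⟩; exact ⟨h1, rfl⟩

/-- The conditions under which `A_n^ρ` and `A_n^σ`, where `σ = ρ + L / n`, are embedded and meet
exactly in their common boundary. -/
structure Compatible (n : ℕ) (L : ℤ) (ρ : ℝ) : Prop where
  three_le : 3 ≤ n
  left : IsTwist n ρ
  right : IsTwist n (ρ + L / n)
  avoids : AvoidsReal n (2 * π * ρ + π * L / n)
  shift : ∀ i j : ℤ, L = n * j + i → 1 < |i|

lemma Compatible.annulus_inter {n : ℕ} {L : ℤ} {ρ h : ℝ} (H : Compatible n L ρ) (hh : 0 < h) :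
    annulus n h ρ ∩ annulus n h (ρ + L / n) = annulusBoundary n h ρ := by
  have hn : 0 < n := by have := H.three_le; omega
  ext x
  constructor
  · rintro ⟨h1, h2⟩
    obtain ⟨s, v, hv, rfl⟩ := (mem_annulus hn).1 h1
    obtain ⟨s', v', hv', e⟩ := (mem_annulus hn).1 h2
    obtain ⟨rfl, e'⟩ := (point_eq_iff hh).1 e
    rw [mem_annulusBoundary hn]
    rcases hv.1.eq_or_lt with rfl | hv0
    · exact ⟨s, Or.inl rfl⟩
    rcases hv.2.eq_or_lt with rfl | hv1
    · exact ⟨s, Or.inr rfl⟩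
    exact absurd e'.symm (slice_ne H.three_le H.avoids H.shift hv0 hv1)
  · intro hx
    have hsub : ∀ ρ, annulusBoundary n h ρ ⊆ annulus n h ρ := by
      intro ρ x hx
      rw [mem_annulus hn]
      obtain ⟨s, hs | hs⟩ := (mem_annulusBoundary hn).1 hx
      · exact ⟨s, 0, by simp, hs⟩
      · exact ⟨s, 1, by simp, hs⟩
    exact ⟨hsub _ hx, hsub _ (annulusBoundary_add hn h ρ L ▸ hx)⟩

lemma Admissible.compatible {n ℓ : ℕ} {h ρ σ : ℝ} (H : Admissible n ℓ h ρ σ) :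
    ∃ L : ℤ, (L = ℓ ∨ L = -ℓ) ∧ σ = ρ + L / n ∧ Compatible n L ρ := by
  obtain ⟨h5, -, h2, h3, hr⟩ := H
  have hn : (5 : ℝ) ≤ n := by exact_mod_cast h5
  have hℓ : (2 : ℝ) ≤ ℓ := by exact_mod_cast h2
  have hℓ' : (ℓ : ℝ) + 3 ≤ n := by exact_mod_cast h3
  have hn0 : (0 : ℝ) < n := by linarith
  -- As `2 ≤ ℓ ≤ n - 3`, the integer `±ℓ` stays at distance at least 2 from all multiples of `n`.
  have hshift : ∀ L : ℤ, (L = ℓ ∨ L = -ℓ) → ∀ i j : ℤ, L = n * j + i → 1 < |i| := by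
    intro L hL i j hj
    by_contra hi
    have hi := abs_le.1 (not_lt.1 hi)
    have hj1 : j < 2 := by
      by_contra hc
      have := mul_le_mul_of_nonneg_left (not_lt.1 hc) (Int.natCast_nonneg n)
      omega
    have hj2 : -2 < j := by
      by_contra hc
      have := mul_le_mul_of_nonneg_left (not_lt.1 hc) (Int.natCast_nonneg n)
      omega
    interval_cases j <;> omega
  have hpi := pi_pos
  have e1 : (ℓ : ℝ) / (2 * n) = (ℓ / n) / 2 := by ring
  have e2 : π * ℓ / n = π * (ℓ / n) := by ring
  have e3 : π / n = π * (1 / n) := by ring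
  have e4 : 2 * π / n = π * (2 * (1 / n)) := by ring
  have p1 : 0 < 1 / (n : ℝ) := by positivity
  have p2 : 0 < (ℓ : ℝ) / n := by positivity
  have p3 : (ℓ : ℝ) / n + 3 * (1 / n) ≤ 1 := by
    have : (ℓ : ℝ) / n + 3 * (1 / n) = (ℓ + 3) / n := by ring
    rw [this, div_le_one hn0]; exact hℓ'
  rcases hr with ⟨rfl, r1, r2⟩ | ⟨rfl, r1, r2⟩
  · refine ⟨ℓ, Or.inl rfl, by simp, by omega, ⟨r1, ?_⟩, ⟨?_, ?_⟩, Or.inr ?_, hshift _ (Or.inl rfl)⟩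
    · linarith
    · simp only [Int.cast_natCast]; linarith
    · simp only [Int.cast_natCast]; linarith
    -- The upper bound on `ρ` says precisely that the last angle, `2πρ + πℓ/n + 2π/n`, is negative.
    · rw [Int.cast_natCast, e2, e3, e4]
      refine ⟨sin_neg_of_neg_of_neg_pi_lt ?_ ?_, sin_neg_of_neg_of_neg_pi_lt ?_ ?_,
        sin_neg_of_neg_of_neg_pi_lt ?_ ?_⟩ <;> nlinarith
  · refine ⟨-ℓ, Or.inr rfl, by push_cast; ring, by omega, ⟨?_, r2⟩, ⟨?_, ?_⟩, Or.inl ?_,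
      hshift _ (Or.inr rfl)⟩
    · linarith
    · push_cast; rw [neg_div]; linarith
    · push_cast; rw [neg_div]; linarith
    -- The lower bound on `ρ` says precisely that the first angle, `2πρ - πℓ/n`, is positive.
    · push_cast
      rw [mul_neg, neg_div, e2, e3, e4]
      refine ⟨sin_pos_of_pos_of_lt_pi ?_ ?_, sin_pos_of_pos_of_lt_pi ?_ ?_,
        sin_pos_of_pos_of_lt_pi ?_ ?_⟩ <;> nlinarith

/-! ### Developing an annulus into the plane. -/

/-- The side of the regular `n`-gon. -/
def side (n : ℕ) : ℝ := 2 * sin (π / n)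

/-- The displacement of the upper boundary along the lower boundary in the developed annulus. -/
def drift (n : ℕ) (ρ : ℝ) : ℝ := sin (2 * π * ρ + π / n) - sin (π / n)

/-- The width of the developed annulus. -/
def slant (n : ℕ) (h ρ : ℝ) : ℝ := √(h ^ 2 + (cos (π / n) - cos (2 * π * ρ + π / n)) ^ 2)

/-- The development of an annulus, to the left (`ε = 1`) or right (`ε = -1`) of the real axis. -/
def chart (n : ℕ) (h ρ ε s v : ℝ) : ℂ :=
  side n * s + v * (drift n ρ + ε * slant n h ρ * Complex.I)

@[simp] lemma chart_re (n : ℕ) (h ρ ε s v : ℝ) :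
    (chart n h ρ ε s v).re = side n * s + v * drift n ρ := by
  simp [chart]

@[simp] lemma chart_im (n : ℕ) (h ρ ε s v : ℝ) :
    (chart n h ρ ε s v).im = v * (ε * slant n h ρ) := by
  simp [chart]

lemma side_pos {n : ℕ} (hn : 3 ≤ n) : 0 < side n := by
  have := chordSin_one_pos (by omega : 2 ≤ n)
  rw [chordSin, Int.cast_one, mul_one] at this
  rw [side]
  positivity

lemma slant_pos {h : ℝ} (hh : 0 < h) (n : ℕ) (ρ : ℝ) : 0 < slant n h ρ := by
  unfold slant; positivity

lemma norm_smul_add_smul_eq {E F : Type*} [NormedAddCommGroup E] [InnerProductSpace ℝ E]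
    [NormedAddCommGroup F] [InnerProductSpace ℝ F] {b c : E} {b' c' : F} (hb : ‖b‖ ^ 2 = ‖b'‖ ^ 2)
    (hc : ‖c‖ ^ 2 = ‖c'‖ ^ 2) (hbc : ‖b - c‖ ^ 2 = ‖b' - c'‖ ^ 2) (x y : ℝ) :
    ‖x • b + y • c‖ = ‖x • b' + y • c'‖ := by
  have h1 := @norm_sub_sq_real E _ _ b c
  have h2 := @norm_sub_sq_real F _ _ b' c'
  have h3 : inner ℝ b c = inner ℝ b' c' := by linarith
  rw [← sq_eq_sq₀ (norm_nonneg _) (norm_nonneg _), norm_add_sq_real, norm_add_sq_real]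
  simp only [inner_smul_left, inner_smul_right, norm_smul, mul_pow, h3, hb, hc]

/-- Three side lengths determine a triangle up to isometry: polarisation recovers the inner products
of the edge vectors. -/
lemma dist_bary_eq {E F : Type*} [NormedAddCommGroup E] [InnerProductSpace ℝ E]
    [NormedAddCommGroup F] [InnerProductSpace ℝ F] {A B C : E} {A' B' C' : F}
    (h1 : ‖B - A‖ ^ 2 = ‖B' - A'‖ ^ 2) (h2 : ‖C - A‖ ^ 2 = ‖C' - A'‖ ^ 2)
    (h3 : ‖B - C‖ ^ 2 = ‖B' - C'‖ ^ 2) {p q r p' q' r' : ℝ} (hs : p + q + r = 1)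
    (hs' : p' + q' + r' = 1) :
    dist (p • A + q • B + r • C) (p' • A + q' • B + r' • C) =
      dist (p • A' + q • B' + r • C') (p' • A' + q' • B' + r' • C') := by
  have hp : p = 1 - q - r := by linarith
  have hp' : p' = 1 - q' - r' := by linarith
  subst hp hp'
  have key := norm_smul_add_smul_eq (b := B - A) (c := C - A) (b' := B' - A') (c' := C' - A') h1 h2
    (by simpa using h3) (q - q') (r - r')
  rw [dist_eq_norm, dist_eq_norm]
  have e1 : (1 - q - r) • A + q • B + r • C - ((1 - q' - r') • A + q' • B + r' • C) =
      (q - q') • (B - A) + (r - r') • (C - A) := by module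
  have e2 : (1 - q - r) • A' + q • B' + r • C' - ((1 - q' - r') • A' + q' • B' + r' • C') =
      (q - q') • (B' - A') + (r - r') • (C' - A') := by module
  rw [e1, e2, key]

lemma norm_cis_sub_cis_sq (x y : ℝ) : ‖cis x - cis y‖ ^ 2 = 2 - 2 * cos (x - y) := by
  rw [← Complex.normSq_eq_norm_sq, Complex.normSq_apply, cos_sub]
  simp
  nlinarith [sin_sq_add_cos_sq x, sin_sq_add_cos_sq y]

lemma norm_toLp_sub_sq (a b : ℂ) (x y : ℝ) :
    ‖(WithLp.toLp 2 (a, x) : E3) - WithLp.toLp 2 (b, y)‖ ^ 2 = ‖a - b‖ ^ 2 + (x - y) ^ 2 := by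
  rw [← WithLp.toLp_sub, WithLp.prod_norm_sq_eq_of_L2]
  simp

lemma norm_sq_re_im (z : ℂ) : ‖z‖ ^ 2 = z.re ^ 2 + z.im ^ 2 := by
  rw [← Complex.normSq_eq_norm_sq, Complex.normSq_apply]; ring

lemma slant_sq (n : ℕ) (h ρ : ℝ) :
    slant n h ρ ^ 2 = h ^ 2 + (cos (π / n) - cos (2 * π * ρ + π / n)) ^ 2 :=
  sq_sqrt (by positivity)

/-- `drift` and `slant` are the components of `Q₁ - P₁` along and across the edge `P₀P₁` within the
plane of the lower triangle. This lemma and the next give the lengths of the two kinds of edges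
joining the polygons, as needed for matching triangles with their developments. -/
lemma drift_sq_add (n : ℕ) (h ρ : ℝ) :
    drift n ρ ^ 2 + slant n h ρ ^ 2 = 2 - 2 * cos (2 * π * ρ) + h ^ 2 := by
  have e : 2 * π * ρ = (2 * π * ρ + π / n) - π / n := by ring
  conv_rhs => rw [e, cos_sub]
  rw [slant_sq, drift]
  nlinarith [sin_sq_add_cos_sq (π / n), sin_sq_add_cos_sq (2 * π * ρ + π / n)]

lemma side_add_drift_sq_add (n : ℕ) (h ρ : ℝ) :
    (side n + drift n ρ) ^ 2 + slant n h ρ ^ 2 = 2 - 2 * cos (2 * π * ρ + 2 * π / n) + h ^ 2 := by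
  have e : 2 * π * ρ + 2 * π / n = (2 * π * ρ + π / n) + π / n := by ring
  rw [e, cos_add, slant_sq, drift, side]
  nlinarith [sin_sq_add_cos_sq (π / n), sin_sq_add_cos_sq (2 * π * ρ + π / n)]

lemma side_sq (n : ℕ) : side n ^ 2 = 2 - 2 * cos (2 * π / n) := by
  have e : 2 * π / n = 2 * (π / n) := by ring
  rw [e, cos_two_mul, side, mul_pow, sin_sq]
  ring

lemma norm_vertexP_sub (n : ℕ) (k : ℕ) : ‖vertexP n (k + 1) - vertexP n k‖ ^ 2 = side n ^ 2 := by
  rw [vertexP_eq, vertexP_eq, norm_toLp_sub_sq, norm_cis_sub_cis_sq, side_sq,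
    show 2 * π * ((k + 1 : ℕ) : ℝ) / n - 2 * π * k / n = 2 * π / n by push_cast; ring]
  ring

lemma norm_vertexQ_sub (n : ℕ) (h ρ : ℝ) (k : ℕ) :
    ‖vertexQ n h ρ (k + 1) - vertexQ n h ρ k‖ ^ 2 = side n ^ 2 := by
  rw [vertexQ_eq, vertexQ_eq, norm_toLp_sub_sq, ← cis_add, ← cis_add, norm_cis_sub_cis_sq, side_sq,
    show 2 * π * ρ + 2 * π * ((k + 1 : ℕ) : ℝ) / n - (2 * π * ρ + 2 * π * k / n) = 2 * π / n by
      push_cast; ring]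
  ring

lemma norm_vertexQ_sub_vertexP (n : ℕ) (h ρ : ℝ) (k : ℕ) :
    ‖vertexQ n h ρ k - vertexP n k‖ ^ 2 = drift n ρ ^ 2 + slant n h ρ ^ 2 := by
  rw [vertexQ_eq, vertexP_eq, norm_toLp_sub_sq, ← cis_add, norm_cis_sub_cis_sq, drift_sq_add,
    add_sub_cancel_right, sub_zero]

lemma norm_vertexQ_succ_sub_vertexP (n : ℕ) (h ρ : ℝ) (k : ℕ) :
    ‖vertexQ n h ρ (k + 1) - vertexP n k‖ ^ 2 =
      (side n + drift n ρ) ^ 2 + slant n h ρ ^ 2 := by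
  rw [vertexQ_eq, vertexP_eq, norm_toLp_sub_sq, ← cis_add, norm_cis_sub_cis_sq,
    side_add_drift_sq_add, sub_zero,
    show 2 * π * ρ + 2 * π * ((k + 1 : ℕ) : ℝ) / n - 2 * π * k / n = 2 * π * ρ + 2 * π / n by
      push_cast; ring]

/-- The weights are those of `point_lower`, so `chart` and `point` correspond by an affine map on
each triangle. -/
lemma chart_lower (n : ℕ) (h ρ ε : ℝ) (k : ℕ) (t v : ℝ) :
    chart n h ρ ε (k + t) v = (1 - t) • chart n h ρ ε k 0 + (t - v) • chart n h ρ ε (k + 1) 0 +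
      v • chart n h ρ ε (k + 1) 1 := by
  apply Complex.ext
  · simp; ring
  · simp

lemma chart_upper (n : ℕ) (h ρ ε : ℝ) (k : ℕ) (t v : ℝ) :
    chart n h ρ ε (k + t) v = t • chart n h ρ ε (k + 1) 1 + (v - t) • chart n h ρ ε k 1 +
      (1 - v) • chart n h ρ ε k 0 := by
  apply Complex.ext
  · simp; ring
  · simp; ring

lemma dist_lower {n : ℕ} {h ρ ε : ℝ} (hε : ε ^ 2 = 1) (k : ℕ) {p q r p' q' r' : ℝ}
    (hs : p + q + r = 1) (hs' : p' + q' + r' = 1) :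
    dist (p • vertexP n k + q • vertexP n (k + 1) + r • vertexQ n h ρ (k + 1))
        (p' • vertexP n k + q' • vertexP n (k + 1) + r' • vertexQ n h ρ (k + 1)) =
      dist (p • chart n h ρ ε k 0 + q • chart n h ρ ε (k + 1) 0 + r • chart n h ρ ε (k + 1) 1)
        (p' • chart n h ρ ε k 0 + q' • chart n h ρ ε (k + 1) 0 + r' • chart n h ρ ε (k + 1) 1) := by
  refine dist_bary_eq ?_ ?_ ?_ hs hs'
  · rw [norm_vertexP_sub, norm_sq_re_im]
    simp; ring
  · rw [norm_vertexQ_succ_sub_vertexP, norm_sq_re_im]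
    simp
    linear_combination (-slant n h ρ ^ 2) * hε
  · rw [norm_sub_rev, norm_vertexQ_sub_vertexP, norm_sq_re_im]
    simp
    linear_combination (-slant n h ρ ^ 2) * hε

lemma dist_upper {n : ℕ} {h ρ ε : ℝ} (hε : ε ^ 2 = 1) (k : ℕ) {p q r p' q' r' : ℝ}
    (hs : p + q + r = 1) (hs' : p' + q' + r' = 1) :
    dist (p • vertexQ n h ρ (k + 1) + q • vertexQ n h ρ k + r • vertexP n k)
        (p' • vertexQ n h ρ (k + 1) + q' • vertexQ n h ρ k + r' • vertexP n k) =
      dist (p • chart n h ρ ε (k + 1) 1 + q • chart n h ρ ε k 1 + r • chart n h ρ ε k 0)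
        (p' • chart n h ρ ε (k + 1) 1 + q' • chart n h ρ ε k 1 + r' • chart n h ρ ε k 0) := by
  refine dist_bary_eq ?_ ?_ ?_ hs hs'
  · rw [norm_sub_rev, norm_vertexQ_sub, norm_sq_re_im]
    simp; ring
  · rw [norm_sub_rev, norm_vertexQ_succ_sub_vertexP, norm_sq_re_im]
    simp
    linear_combination (-slant n h ρ ^ 2) * hε
  · rw [norm_vertexQ_sub_vertexP, norm_sq_re_im]
    simp
    linear_combination (-slant n h ρ ^ 2) * hε

/-- The vertices of the triangles which make up the developed annulus. -/
def chartTriangle (n : ℕ) (h ρ ε : ℝ) (k : ℕ) (isLower : Bool) : Fin 3 → ℂ :=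
  bif isLower then
    ![chart n h ρ ε k 0, chart n h ρ ε (k + 1) 0, chart n h ρ ε (k + 1) 1]
  else ![chart n h ρ ε (k + 1) 1, chart n h ρ ε k 1, chart n h ρ ε k 0]

lemma affineIndependent_chartTriangle {n : ℕ} (hn : 3 ≤ n) {h ρ ε : ℝ} (hh : 0 < h)
    (hε : ε ^ 2 = 1) (k : ℕ) (b : Bool) : AffineIndependent ℝ (chartTriangle n h ρ ε k b) := by
  have ha := (side_pos hn).ne'
  have hs := (slant_pos hh n ρ).ne'
  have hε0 : ε ≠ 0 := by rintro rfl; norm_num at hε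
  rw [affineIndependent_iff_of_fintype]
  intro w hw hw0
  rw [Finset.weightedVSub_eq_weightedVSubOfPoint_of_sum_eq_zero _ _ _ hw 0,
    Finset.weightedVSubOfPoint_apply] at hw0
  simp only [Fin.sum_univ_three] at hw hw0
  have hre := congrArg Complex.re hw0
  have him := congrArg Complex.im hw0
  have e0 : w 0 = -w 1 - w 2 := by linarith
  cases b
  · simp [chartTriangle] at hre him
    have h01 : w 0 + w 1 = 0 := by
      have : (w 0 + w 1) * (ε * slant n h ρ) = 0 := by linarith
      exact (mul_eq_zero.1 this).resolve_right (mul_ne_zero hε0 hs)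
    have h2 : w 2 = 0 := by linarith
    have h0 : w 0 = 0 := by
      have e1 : w 1 = - w 0 := by linarith
      rw [h2, e1] at hre
      have : w 0 * side n = 0 := by linarith
      exact (mul_eq_zero.1 this).resolve_right ha
    intro i
    fin_cases i
    · exact h0
    · show w 1 = 0
      linarith
    · exact h2
  · simp [chartTriangle, hε0, hs] at hre him
    have h1 : w 1 = 0 := by
      rw [him, show w 0 = - w 1 by linarith] at hre
      have : w 1 * side n = 0 := by linarith
      exact (mul_eq_zero.1 this).resolve_right ha
    intro i
    fin_cases i
    · show w 0 = 0
      linarith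
    · exact h1
    · exact him

lemma range_vec3 {E : Type*} (a b c : E) : Set.range ![a, b, c] = {a, b, c} := by
  simp only [Matrix.range_cons, Matrix.range_empty, Set.union_empty, Set.singleton_union]

lemma dist_point_eq_of_mem_chartTriangle {n : ℕ} {h ρ ε : ℝ} (hε : ε ^ 2 = 1) {k : ℕ} {b : Bool}
    {z w : ℂ} (hz : z ∈ convexHull ℝ (Set.range (chartTriangle n h ρ ε k b)))
    (hw : w ∈ convexHull ℝ (Set.range (chartTriangle n h ρ ε k b))) :
    ∃ s v s' v' : ℝ, v ∈ Set.Icc (0 : ℝ) 1 ∧ v' ∈ Set.Icc (0 : ℝ) 1 ∧ z = chart n h ρ ε s v ∧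
      w = chart n h ρ ε s' v' ∧ dist (point n h ρ s v) (point n h ρ s' v') = dist z w := by
  cases b
  · simp only [chartTriangle, cond_false, range_vec3, mem_convexHull_triple] at hz hw
    obtain ⟨p, q, r, hp, hq, hr, hs, rfl⟩ := hz
    obtain ⟨p', q', r', hp', hq', hr', hs', rfl⟩ := hw
    refine ⟨k + p, p + q, k + p', p' + q', ⟨by positivity, by linarith⟩,
      ⟨by positivity, by linarith⟩, ?_, ?_, ?_⟩
    · rw [chart_upper n h ρ ε k p, add_sub_cancel_left, show 1 - (p + q) = r by linarith]
    · rw [chart_upper n h ρ ε k p', add_sub_cancel_left, show 1 - (p' + q') = r' by linarith]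
    · rw [point_upper hp (by linarith) (by linarith), point_upper hp' (by linarith) (by linarith),
        ← dist_upper hε k hs hs', add_sub_cancel_left, add_sub_cancel_left,
        show 1 - (p + q) = r by linarith, show 1 - (p' + q') = r' by linarith]
  · simp only [chartTriangle, cond_true, range_vec3, mem_convexHull_triple] at hz hw
    obtain ⟨p, q, r, hp, hq, hr, hs, rfl⟩ := hz
    obtain ⟨p', q', r', hp', hq', hr', hs', rfl⟩ := hw
    refine ⟨k + (q + r), r, k + (q' + r'), r', ⟨hr, by linarith⟩,
      ⟨hr', by linarith⟩, ?_, ?_, ?_⟩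
    · rw [chart_lower n h ρ ε k (q + r), add_sub_cancel_right, show 1 - (q + r) = p by linarith]
    · rw [chart_lower n h ρ ε k (q' + r'), add_sub_cancel_right, show 1 - (q' + r') = p' by linarith]
    · rw [point_lower hr (by linarith) (by linarith), point_lower hr' (by linarith) (by linarith),
        ← dist_lower hε k hs hs', add_sub_cancel_right, add_sub_cancel_right,
        show 1 - (q + r) = p by linarith, show 1 - (q' + r') = p' by linarith]

lemma chart_mem_chartTriangle (n : ℕ) (h ρ ε : ℝ) (k : ℕ) {t v : ℝ} (ht : t ∈ Set.Icc (0 : ℝ) 1)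
    (hv : v ∈ Set.Icc (0 : ℝ) 1) :
    ∃ b, chart n h ρ ε (k + t) v ∈ convexHull ℝ (Set.range (chartTriangle n h ρ ε k b)) := by
  rcases le_total v t with hvt | hvt
  · refine ⟨true, ?_⟩
    simp only [chartTriangle, cond_true, range_vec3, mem_convexHull_triple]
    exact ⟨1 - t, t - v, v, by linarith [ht.2], by linarith, hv.1, by ring,
      (chart_lower n h ρ ε k t v).symm⟩
  · refine ⟨false, ?_⟩
    simp only [chartTriangle, cond_false, range_vec3, mem_convexHull_triple]
    exact ⟨t, v - t, 1 - v, ht.1, by linarith, by linarith [hv.2], by ring,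
      (chart_upper n h ρ ε k t v).symm⟩

/-! ### The period lattice and the folding map of the plane. -/

/-- The translation of the developed torus which identifies its two upper boundaries. -/
def translation (n : ℕ) (h ρ : ℝ) (L : ℤ) : ℂ :=
  chart n h ρ 1 0 1 - chart n h (ρ + L / n) (-1) (-L) 1

lemma translation_re (n : ℕ) (h ρ : ℝ) (L : ℤ) :
    (translation n h ρ L).re = drift n ρ - drift n (ρ + L / n) + side n * L := by
  simp [translation]; ring

lemma translation_im (n : ℕ) (h ρ : ℝ) (L : ℤ) :
    (translation n h ρ L).im = slant n h ρ + slant n h (ρ + L / n) := by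
  simp [translation]

/-- The lattice of periods of the developed torus. -/
def periods (n : ℕ) (h ρ : ℝ) (L : ℤ) : AddSubgroup ℂ :=
  AddSubgroup.closure {((n * side n : ℝ) : ℂ), translation n h ρ L}

lemma side_mem_periods (n : ℕ) (h ρ : ℝ) (L : ℤ) :
    ((n * side n : ℝ) : ℂ) ∈ periods n h ρ L :=
  AddSubgroup.subset_closure (Set.mem_insert _ _)

lemma translation_mem_periods (n : ℕ) (h ρ : ℝ) (L : ℤ) :
    translation n h ρ L ∈ periods n h ρ L :=
  AddSubgroup.subset_closure (Set.mem_insert_of_mem _ rfl)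

/-- `point`, with the relative height clamped to the unit interval. -/
def clampedPoint (n : ℕ) (h ρ s v : ℝ) : E3 := point n h ρ s (max 0 (min v 1))

lemma clampedPoint_eq {n : ℕ} {h ρ s v : ℝ} (hv : v ∈ Set.Icc (0 : ℝ) 1) :
    clampedPoint n h ρ s v = point n h ρ s v := by
  rw [clampedPoint, min_eq_left hv.2, max_eq_right hv.1]

lemma continuous_clampedPoint (n : ℕ) (h ρ : ℝ) {X : Type*} [TopologicalSpace X] {f g : X → ℝ}
    (hf : Continuous f) (hg : Continuous g) : Continuous fun x => clampedPoint n h ρ (f x) (g x) := by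
  unfold clampedPoint point
  exact (WithLp.prod_continuous_toLp 2 ℂ ℝ).comp
    (((continuous_slice n ρ).comp (hf.prodMk hg)).prodMk (by fun_prop))

/-- The folding map on the strip `0 ≤ Im ≤ Im T`, where `T` is the translation of the torus. The
argument `z` is only relevant up to real multiples of `T`, and `u` is the coordinate along `T`. -/
def stripMap (n : ℕ) (h ρ σ : ℝ) (T z : ℂ) (u : ℝ) : E3 :=
  if u * T.im ≤ slant n h ρ then
    clampedPoint n h ρ
      ((z.re - z.im / T.im * T.re + u * T.re - u * T.im / slant n h ρ * drift n ρ) / side n)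
      (u * T.im / slant n h ρ)
  else
    clampedPoint n h σ
      ((z.re - z.im / T.im * T.re + (u - 1) * T.re - (1 - u) * T.im / slant n h σ * drift n σ) /
        side n)
      ((1 - u) * T.im / slant n h σ)

/-- The folding map of the plane. -/
def fold (n : ℕ) (h ρ : ℝ) (L : ℤ) (z : ℂ) : E3 :=
  stripMap n h ρ (ρ + L / n) (translation n h ρ L) z
    (Int.fract (z.im / (translation n h ρ L).im))

section

variable {n : ℕ} {h ρ : ℝ} {L : ℤ}

lemma translation_im_pos (hh : 0 < h) : 0 < (translation n h ρ L).im := by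
  rw [translation_im]
  exact add_pos (slant_pos hh _ _) (slant_pos hh _ _)

/-- The two branches meet where both relative heights are 1, on the common upper polygon; `hglue` is
their agreement there. -/
lemma continuous_stripMap (hh : 0 < h) {σ : ℝ} {T : ℂ} (hT : T.im = slant n h ρ + slant n h σ)
    (hglue : ∀ r, point n h ρ ((r + T.re - drift n ρ) / side n) 1 =
      point n h σ ((r - drift n σ) / side n) 1) :
    Continuous fun x : ℂ × ℝ => stripMap n h ρ σ T x.1 x.2 := by
  have hs := (slant_pos hh n ρ).ne'
  have hs' := (slant_pos hh n σ).ne'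
  unfold stripMap
  refine Continuous.if_le (continuous_clampedPoint _ _ _ (by fun_prop) (by fun_prop))
    (continuous_clampedPoint _ _ _ (by fun_prop) (by fun_prop)) (by fun_prop) continuous_const ?_
  intro x hx
  have e1 : (1 - x.2) * T.im / slant n h σ = 1 := by
    rw [div_eq_one_iff_eq hs', sub_mul, hx, hT]
    ring
  have e2 := hglue (x.1.re - x.1.im / T.im * T.re + (x.2 - 1) * T.re)
  rw [hx, div_self hs, e1, clampedPoint_eq (by simp), clampedPoint_eq (by simp), one_mul, one_mul]
  refine Eq.trans ?_ e2
  have e3 : x.1.re - x.1.im / T.im * T.re + x.2 * T.re - drift n ρ =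
      x.1.re - x.1.im / T.im * T.re + (x.2 - 1) * T.re + T.re - drift n ρ := by ring
  rw [e3]

/-- Both ends of the strip lie on the lower polygon. The agreement lets `fold` cross the jumps of
`Int.fract` continuously. -/
lemma stripMap_zero (hh : 0 < h) {σ : ℝ} {T : ℂ} (hT : T.im = slant n h ρ + slant n h σ) (z : ℂ) :
    stripMap n h ρ σ T z 0 = stripMap n h ρ σ T z 1 := by
  have hs := slant_pos hh n ρ
  have hs' := slant_pos hh n σ
  have h1 : ¬ (1 * T.im ≤ slant n h ρ) := by
    rw [hT]; linarith
  rw [stripMap, stripMap, if_pos (by simpa using hs.le), if_neg h1]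
  simp only [zero_mul, zero_div, sub_self, add_zero, sub_zero]
  rw [clampedPoint_eq (by simp), clampedPoint_eq (by simp), point_zero]

lemma continuous_fold (hn : 3 ≤ n) (hh : 0 < h) : Continuous (fold n h ρ L) := by
  have ha := (side_pos hn).ne'
  refine ContinuousOn.comp_fract (s := fun z : ℂ => z.im / (translation n h ρ L).im)
    (continuous_stripMap hh (translation_im n h ρ L) ?_).continuousOn (by fun_prop)
    (stripMap_zero hh (translation_im n h ρ L))
  intro r
  rw [point_one (by omega), translation_re]
  generalize ρ + (L : ℝ) / n = σ
  congr 1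
  field_simp
  ring

lemma fold_add_translation (hh : 0 < h) (z : ℂ) :
    fold n h ρ L (z + translation n h ρ L) = fold n h ρ L z := by
  have hT := (translation_im_pos (n := n) (ρ := ρ) (L := L) hh).ne'
  have e : (z + translation n h ρ L).im / (translation n h ρ L).im =
      z.im / (translation n h ρ L).im + 1 := by
    rw [Complex.add_im, add_div, div_self hT]
  rw [fold, fold, e, Int.fract_add_one, stripMap, stripMap, e, Complex.add_re]
  ring_nf

lemma fold_add_side (hn : 3 ≤ n) (z : ℂ) :
    fold n h ρ L (z + (n * side n : ℝ)) = fold n h ρ L z := by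
  have ha := (side_pos hn).ne'
  have per : ∀ σ s v, clampedPoint n h σ (s + n) v = clampedPoint n h σ s v := by
    intro σ s v
    have := point_add_period (by omega : 0 < n) h σ s (max 0 (min v 1)) 1
    simpa [clampedPoint] using this
  have im : (z + (n * side n : ℝ)).im = z.im := by simp
  have re : (z + (n * side n : ℝ)).re = z.re + n * side n := by simp
  rw [fold, fold, im, stripMap, stripMap, im, re]
  generalize ρ + (L : ℝ) / n = σ
  congr 1
  · symm
    rw [← per]
    congr 1
    field_simp
    ring
  · symm
    rw [← per]
    congr 1
    field_simp
    ring

lemma fold_add_of_mem_periods (hn : 3 ≤ n) (hh : 0 < h) {p : ℂ} (hp : p ∈ periods n h ρ L) :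
    ∀ z, fold n h ρ L (z + p) = fold n h ρ L z := by
  induction hp using AddSubgroup.closure_induction with
  | mem x hx =>
    rcases hx with rfl | rfl
    · exact fold_add_side hn
    · exact fold_add_translation hh
  | zero => intro z; rw [add_zero]
  | add x y _ _ hx hy => intro z; rw [← add_assoc, hy, hx]
  | neg x _ hx => intro z; rw [← hx (z + -x), neg_add_cancel_right]

lemma fold_chart_left (hn : 3 ≤ n) (hh : 0 < h) (s : ℝ) {v : ℝ} (hv : v ∈ Set.Icc (0 : ℝ) 1) :
    fold n h ρ L (chart n h ρ 1 s v) = point n h ρ s v := by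
  have ha := (side_pos hn).ne'
  have hs := slant_pos hh n ρ
  have hs' := slant_pos hh n (ρ + L / n)
  have hT := translation_im_pos (n := n) (ρ := ρ) (L := L) hh
  have hle : v * slant n h ρ ≤ slant n h ρ := mul_le_of_le_one_left hs.le hv.2
  have hf : Int.fract (v * slant n h ρ / (translation n h ρ L).im) =
      v * slant n h ρ / (translation n h ρ L).im := by
    rw [Int.fract_eq_self]
    refine ⟨div_nonneg (mul_nonneg hv.1 hs.le) hT.le, ?_⟩
    rw [div_lt_one hT, translation_im]
    linarith
  have him : (chart n h ρ 1 s v).im = v * slant n h ρ := by simp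
  rw [fold, him, hf, stripMap, him, chart_re]
  simp only [div_mul_cancel₀ _ hT.ne', sub_add_cancel]
  rw [if_pos hle, mul_div_cancel_right₀ _ hs.ne', clampedPoint_eq hv]
  congr 1
  field_simp
  ring

lemma fold_chart_right (hn : 3 ≤ n) (hh : 0 < h) (s : ℝ) {v : ℝ} (hv : v ∈ Set.Icc (0 : ℝ) 1) :
    fold n h ρ L (chart n h (ρ + L / n) (-1) s v) = point n h (ρ + L / n) s v := by
  have ha := (side_pos hn).ne'
  have hs := slant_pos hh n ρ
  have hs' := slant_pos hh n (ρ + L / n)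
  have hT := translation_im_pos (n := n) (ρ := ρ) (L := L) hh
  -- On the edges `v = 0` and `v = 1`, `fold` uses the branch of the left annulus, so the gluing of
  -- the boundaries is needed.
  rcases hv.1.eq_or_lt with rfl | hv0
  · have e : chart n h (ρ + L / n) (-1) s 0 = chart n h ρ 1 s 0 := by simp [chart]
    rw [e, fold_chart_left hn hh s (by simp), point_zero]
  rcases hv.2.eq_or_lt with rfl | hv1
  · have e : chart n h (ρ + L / n) (-1) s 1 + translation n h ρ L = chart n h ρ 1 (s + L) 1 := by
      simp [chart, translation]; ring
    rw [← fold_add_translation hh, e, fold_chart_left hn hh _ (by simp), point_one (by omega)]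
  have hle : v * slant n h (ρ + L / n) < slant n h (ρ + L / n) :=
    mul_lt_of_lt_one_left hs' hv1
  have hpos : 0 < v * slant n h (ρ + L / n) := mul_pos hv0 hs'
  -- The right strip lies below the real axis; translation moves it onto the upper part of the strip
  -- where `fold` is defined.
  rw [← fold_add_translation hh]
  have him : (chart n h (ρ + L / n) (-1) s v + translation n h ρ L).im =
      (translation n h ρ L).im - v * slant n h (ρ + L / n) := by simp; ring
  have hre : (chart n h (ρ + L / n) (-1) s v + translation n h ρ L).re =
      side n * s + v * drift n (ρ + L / n) + (translation n h ρ L).re := by simp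
  have hTi := translation_im n h ρ L
  set T := translation n h ρ L
  have hf : Int.fract ((T.im - v * slant n h (ρ + L / n)) / T.im) =
      (T.im - v * slant n h (ρ + L / n)) / T.im := by
    rw [Int.fract_eq_self]
    refine ⟨div_nonneg (by linarith) hT.le, ?_⟩
    rw [div_lt_one hT]
    linarith
  rw [fold]
  change stripMap n h ρ _ T _ (Int.fract (_ / T.im)) = _
  rw [him, hf, stripMap, him, hre]
  clear_value T
  generalize ρ + (L : ℝ) / n = σ at *
  have e1 : (1 - (T.im - v * slant n h σ) / T.im) * T.im / slant n h σ = v := by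
    field_simp
    ring
  rw [if_neg (by rw [div_mul_cancel₀ _ hT.ne']; linarith), e1, clampedPoint_eq hv]
  congr 1
  field_simp
  ring

lemma exists_chart (hn : 3 ≤ n) (hh : 0 < h) (z : ℂ) :
    ∃ p ∈ periods n h ρ L, ∃ s, ∃ v ∈ Set.Icc (0 : ℝ) 1,
      z = chart n h ρ 1 s v + p ∨ z = chart n h (ρ + L / n) (-1) s v + p := by
  have ha := (side_pos hn).ne'
  have hs := slant_pos hh n ρ
  have hs' := slant_pos hh n (ρ + L / n)
  have hT := translation_im_pos (n := n) (ρ := ρ) (L := L) hh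
  have hTm := translation_mem_periods n h ρ L
  have hTi := translation_im n h ρ L
  set T := translation n h ρ L with hTdef
  have f0 := Int.fract_nonneg (z.im / T.im)
  have f1 := Int.fract_lt_one (z.im / T.im)
  have hfl : z.im = ⌊z.im / T.im⌋ * T.im + Int.fract (z.im / T.im) * T.im := by
    rw [← add_mul, Int.floor_add_fract, div_mul_cancel₀ _ hT.ne']
  set f := Int.fract (z.im / T.im)
  set j := ⌊z.im / T.im⌋
  clear_value T
  generalize ρ + (L : ℝ) / n = σ at hs' hTi ⊢
  rcases le_total (f * T.im) (slant n h ρ) with hle | hle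
  · refine ⟨j • T, zsmul_mem hTm j, (z.re - j * T.re - f * T.im / slant n h ρ * drift n ρ) / side n,
      f * T.im / slant n h ρ, ⟨by positivity, by rwa [div_le_one hs]⟩, Or.inl ?_⟩
    apply Complex.ext
    · simp
      field_simp
      ring
    · simp
      field_simp
      linarith
  · refine ⟨(j + 1) • T, zsmul_mem hTm _, (z.re - (j + 1) * T.re -
      (1 - f) * T.im / slant n h σ * drift n σ) / side n,
      (1 - f) * T.im / slant n h σ,
      ⟨div_nonneg (mul_nonneg (by linarith) hT.le) hs'.le, ?_⟩, Or.inr ?_⟩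
    · rw [div_le_one hs']
      linarith
    · apply Complex.ext
      · simp
        field_simp
        ring
      · simp
        field_simp
        linarith

lemma chart_add_period (n : ℕ) (h ρ ε s v : ℝ) (j : ℤ) :
    chart n h ρ ε (s + n * j) v = chart n h ρ ε s v + j • ((n * side n : ℝ) : ℂ) := by
  apply Complex.ext
  · simp; ring
  · simp

lemma chart_sub_chart_mem_periods {σ ε s s' v : ℝ} (j : ℤ) (hj : s' = s + n * j) :
    chart n h σ ε s' v - chart n h σ ε s v ∈ periods n h ρ L := by
  rw [hj, chart_add_period, add_sub_cancel_left]
  exact zsmul_mem (side_mem_periods n h ρ L) j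

/-- The annuli meet only at heights 0 and 1. At height 0 the charts agree on the real axis; at
height 1 they differ by `translation`, each time up to horizontal periods. -/
lemma chart_left_sub_chart_right_mem_periods (H : Compatible n L ρ) (hh : 0 < h) {s s' v v' : ℝ}
    (hv : v ∈ Set.Icc (0 : ℝ) 1) (e : point n h ρ s v = point n h (ρ + L / n) s' v') :
    chart n h ρ 1 s v - chart n h (ρ + L / n) (-1) s' v' ∈ periods n h ρ L := by
  have hn := H.three_le
  obtain ⟨rfl, e'⟩ := (point_eq_iff hh).1 e
  rcases hv.1.eq_or_lt with rfl | hv0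
  · rw [point_zero n h (ρ + L / n) ρ] at e
    obtain ⟨j, hj⟩ := slice_injective hn H.left (by simp) ((point_eq_iff hh).1 e).2
    have := chart_sub_chart_mem_periods (h := h) (ρ := ρ) (L := L) (σ := ρ) (ε := 1) (v := 0) j hj
    rw [← neg_mem_iff, neg_sub]
    convert this using 1
    simp [chart]
  rcases hv.2.eq_or_lt with rfl | hv1
  · rw [point_one (by omega)] at e
    obtain ⟨j, hj⟩ := slice_injective hn H.left (by simp) ((point_eq_iff hh).1 e).2
    have := sub_mem (translation_mem_periods n h ρ L)
      (chart_sub_chart_mem_periods (h := h) (ρ := ρ) (L := L) (σ := ρ) (ε := 1) (v := 1) j hj)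
    convert this using 1
    simp [chart, translation]
    ring
  · exact absurd e' (slice_ne hn H.avoids H.shift hv0 hv1)

lemma sub_mem_periods_of_fold_eq (H : Compatible n L ρ) (hh : 0 < h) {z w : ℂ}
    (e : fold n h ρ L z = fold n h ρ L w) : z - w ∈ periods n h ρ L := by
  have hn := H.three_le
  obtain ⟨p, hp, s, v, hv, hz⟩ := exists_chart (ρ := ρ) (L := L) hn hh z
  obtain ⟨q, hq, s', v', hv', hw⟩ := exists_chart (ρ := ρ) (L := L) hn hh w
  have red : ∀ x y : ℂ, x - y ∈ periods n h ρ L → x + p - (y + q) ∈ periods n h ρ L := by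
    intro x y hxy
    have := add_mem hxy (sub_mem hp hq)
    convert this using 1
    ring
  rcases hz with rfl | rfl <;> rcases hw with rfl | rfl <;> apply red <;>
    rw [fold_add_of_mem_periods hn hh hp, fold_add_of_mem_periods hn hh hq] at e
  · rw [fold_chart_left hn hh _ hv, fold_chart_left hn hh _ hv'] at e
    obtain ⟨rfl, e'⟩ := (point_eq_iff hh).1 e
    obtain ⟨j, hj⟩ := slice_injective hn H.left hv e'.symm
    exact chart_sub_chart_mem_periods j hj
  · rw [fold_chart_left hn hh _ hv, fold_chart_right hn hh _ hv'] at e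
    exact chart_left_sub_chart_right_mem_periods H hh hv e
  · rw [fold_chart_right hn hh _ hv, fold_chart_left hn hh _ hv'] at e
    rw [← neg_mem_iff, neg_sub]
    exact chart_left_sub_chart_right_mem_periods H hh hv' e.symm
  · rw [fold_chart_right hn hh _ hv, fold_chart_right hn hh _ hv'] at e
    obtain ⟨rfl, e'⟩ := (point_eq_iff hh).1 e
    obtain ⟨j, hj⟩ := slice_injective hn H.right hv e'.symm
    exact chart_sub_chart_mem_periods j hj

end

/-! ### The origami embedding of the torus. -/

section

variable {n : ℕ} {h ρ : ℝ} {L : ℤ}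

lemma fold_eq_of_leftRel (hn : 3 ≤ n) (hh : 0 < h) (z w : ℂ)
    (e : (QuotientAddGroup.leftRel (periods n h ρ L)) z w) : fold n h ρ L z = fold n h ρ L w := by
  rw [QuotientAddGroup.leftRel_apply] at e
  rw [← fold_add_of_mem_periods hn hh e z, add_neg_cancel_left]

/-- The folding map of the flat torus. -/
def torusFold (hn : 3 ≤ n) (hh : 0 < h) : ℂ ⧸ periods n h ρ L → E3 :=
  Quotient.lift (fold n h ρ L) (fold_eq_of_leftRel hn hh)

lemma torusFold_mk (hn : 3 ≤ n) (hh : 0 < h) (z : ℂ) :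
    torusFold hn hh (z : ℂ ⧸ periods n h ρ L) = fold n h ρ L z := rfl

lemma continuous_torusFold (hn : 3 ≤ n) (hh : 0 < h) :
    Continuous (torusFold hn hh : ℂ ⧸ periods n h ρ L → E3) :=
  (continuous_fold hn hh).quotient_lift _

lemma torusFold_injective (H : Compatible n L ρ) (hh : 0 < h) :
    Function.Injective (torusFold H.three_le hh : ℂ ⧸ periods n h ρ L → E3) := by
  intro x y
  induction x using QuotientAddGroup.induction_on with | H z => ?_
  induction y using QuotientAddGroup.induction_on with | H w => ?_
  intro e
  rw [torusFold_mk, torusFold_mk] at e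
  rw [QuotientAddGroup.eq, ← neg_mem_iff, neg_add_rev, neg_neg, neg_add_eq_sub]
  exact sub_mem_periods_of_fold_eq H hh e

lemma exists_chart_quotient (hn : 3 ≤ n) (hh : 0 < h) (x : ℂ ⧸ periods n h ρ L) :
    ∃ k < n, ∃ t ∈ Set.Icc (0 : ℝ) 1, ∃ v ∈ Set.Icc (0 : ℝ) 1,
      (chart n h ρ 1 (k + t) v : ℂ ⧸ periods n h ρ L) = x ∨
      (chart n h (ρ + L / n) (-1) (k + t) v : ℂ ⧸ periods n h ρ L) = x := by
  induction x using QuotientAddGroup.induction_on with | H z => ?_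
  obtain ⟨p, hp, s, v, hv, hz⟩ := exists_chart (ρ := ρ) (L := L) hn hh z
  obtain ⟨k, t, j, hk, ht, rfl⟩ := exists_fundamental_param (by omega : 0 < n) s
  refine ⟨k, hk, t, ht, v, hv, ?_⟩
  have hj : j • ((n * side n : ℝ) : ℂ) ∈ periods n h ρ L :=
    zsmul_mem (side_mem_periods n h ρ L) j
  rcases hz with rfl | rfl
  · left
    rw [QuotientAddGroup.eq, chart_add_period, add_assoc, neg_add_cancel_left]
    exact add_mem hj hp
  · right
    rw [QuotientAddGroup.eq, chart_add_period, add_assoc, neg_add_cancel_left]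
    exact add_mem hj hp

/-- Two compact parameter rectangles cover the quotient. -/
lemma compactSpace_quotient_periods (hn : 3 ≤ n) (hh : 0 < h) :
    CompactSpace (ℂ ⧸ periods n h ρ L) := by
  have cont : ∀ σ ε : ℝ, Continuous fun x : ℝ × ℝ =>
      (chart n h σ ε x.1 x.2 : ℂ ⧸ periods n h ρ L) := by
    intro σ ε
    refine continuous_quotient_mk'.comp ?_
    unfold chart
    fun_prop
  have K := (isCompact_Icc (a := (0 : ℝ)) (b := n)).prod (isCompact_Icc (a := (0 : ℝ)) (b := 1))
  refine ⟨((K.image (cont ρ 1)).union (K.image (cont (ρ + L / n) (-1)))).of_isClosed_subset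
    isClosed_univ ?_⟩
  intro x _
  obtain ⟨k, hk, t, ht, v, hv, hx⟩ := exists_chart_quotient hn hh x
  have hk' : (k : ℝ) + 1 ≤ n := by exact_mod_cast hk
  have hmem : ((k + t, v) : ℝ × ℝ) ∈ Set.Icc (0 : ℝ) n ×ˢ Set.Icc (0 : ℝ) 1 :=
    ⟨⟨add_nonneg (Nat.cast_nonneg k) ht.1, by linarith [ht.2]⟩, hv⟩
  rcases hx with hx | hx
  · exact Or.inl ⟨_, hmem, hx⟩
  · exact Or.inr ⟨_, hmem, hx⟩

lemma isEmbedding_torusFold (H : Compatible n L ρ) (hh : 0 < h) :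
    Topology.IsEmbedding (torusFold H.three_le hh : ℂ ⧸ periods n h ρ L → E3) :=
  have := compactSpace_quotient_periods (ρ := ρ) (L := L) H.three_le hh
  ((continuous_torusFold H.three_le hh).isClosedEmbedding (torusFold_injective H hh)).isEmbedding

/-- The rotation number of the annulus into which a triangle on one of the two sides of the real
axis is folded. -/
def sideTwist (n : ℕ) (ρ : ℝ) (L : ℤ) (isLeft : Bool) : ℝ := bif isLeft then ρ else ρ + L / n

/-- The sign that describes one of the two sides of the real axis. -/
def sideSign (isLeft : Bool) : ℝ := bif isLeft then 1 else -1

lemma sideSign_sq (b : Bool) : sideSign b ^ 2 = 1 := by cases b <;> simp [sideSign]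

lemma fold_chart (hn : 3 ≤ n) (hh : 0 < h) (b : Bool) (s : ℝ) {v : ℝ}
    (hv : v ∈ Set.Icc (0 : ℝ) 1) :
    fold n h ρ L (chart n h (sideTwist n ρ L b) (sideSign b) s v) =
      point n h (sideTwist n ρ L b) s v := by
  cases b
  · exact fold_chart_right hn hh s hv
  · exact fold_chart_left hn hh s hv

lemma isOrigamiEmbedding_torusFold (H : Compatible n L ρ) (hh : 0 < h) :
    IsOrigamiEmbedding (periods n h ρ L) (torusFold H.three_le hh) := by
  have hn := H.three_le
  refine ⟨isEmbedding_torusFold H hh, ?_⟩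
  let e := Fintype.equivFin (Fin n × Bool × Bool)
  refine ⟨Fintype.card (Fin n × Bool × Bool), fun i => chartTriangle n h
    (sideTwist n ρ L (e.symm i).2.1) (sideSign (e.symm i).2.1) (e.symm i).1 (e.symm i).2.2,
    fun i => affineIndependent_chartTriangle hn hh (sideSign_sq _) _ _, ?_, ?_⟩
  · intro x
    obtain ⟨k, hk, t, ht, v, hv, hx⟩ := exists_chart_quotient hn hh x
    obtain ⟨b, hb⟩ : ∃ b, (chart n h (sideTwist n ρ L b) (sideSign b) (k + t) v :
        ℂ ⧸ periods n h ρ L) = x := by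
      rcases hx with hx | hx
      · exact ⟨true, hx⟩
      · exact ⟨false, hx⟩
    obtain ⟨c, hc⟩ := chart_mem_chartTriangle n h (sideTwist n ρ L b) (sideSign b) k ht hv
    refine ⟨e (⟨k, hk⟩, b, c), _, ?_, hb⟩
    simpa using hc
  · intro i z hz w hw
    obtain ⟨s, v, s', v', hv, hv', rfl, rfl, hd⟩ :=
      dist_point_eq_of_mem_chartTriangle (sideSign_sq _) hz hw
    rw [torusFold_mk, torusFold_mk, fold_chart hn hh _ _ hv, fold_chart hn hh _ _ hv', hd]

lemma range_torusFold (hn : 3 ≤ n) (hh : 0 < h) :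
    Set.range (torusFold hn hh : ℂ ⧸ periods n h ρ L → E3) =
      annulus n h ρ ∪ annulus n h (ρ + L / n) := by
  have hn0 : 0 < n := by omega
  ext y
  constructor
  · rintro ⟨x, rfl⟩
    obtain ⟨k, hk, t, ht, v, hv, rfl | rfl⟩ := exists_chart_quotient hn hh x
    · left
      rw [torusFold_mk, fold_chart_left hn hh _ hv]
      exact (mem_annulus hn0).2 ⟨_, v, hv, rfl⟩
    · right
      rw [torusFold_mk, fold_chart_right hn hh _ hv]
      exact (mem_annulus hn0).2 ⟨_, v, hv, rfl⟩
  · rintro (hy | hy)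
    · obtain ⟨s, v, hv, rfl⟩ := (mem_annulus hn0).1 hy
      exact ⟨(chart n h ρ 1 s v : ℂ), by rw [torusFold_mk, fold_chart_left hn hh _ hv]⟩
    · obtain ⟨s, v, hv, rfl⟩ := (mem_annulus hn0).1 hy
      exact ⟨(chart n h (ρ + L / n) (-1) s v : ℂ), by
        rw [torusFold_mk, fold_chart_right hn hh _ hv]⟩

lemma dist_vertexP (hn : 3 ≤ n) : dist (vertexP n 0) (vertexP n 1) = side n := by
  have := norm_vertexP_sub n 0
  rw [sq_eq_sq₀ (norm_nonneg _) (side_pos hn).le] at this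
  rw [dist_comm, dist_eq_norm]
  exact this

lemma innerOnLeft_torusFold (hn : 3 ≤ n) (hh : 0 < h) :
    InnerOnLeft n h ρ (periods n h ρ L) (torusFold hn hh) := by
  have hs := slant_pos hh n ρ
  have ha := side_pos hn
  -- The edge is developed along the real axis, and the left strip, in the upper half plane, has
  -- width `slant n h ρ`.
  refine ⟨0, 1, slant n h ρ, by simp, hs, ?_⟩
  intro s hsm
  rw [dist_vertexP hn]
  constructor
  · have e : (0 + ((s * side n : ℝ) : ℂ) * 1) = chart n h ρ 1 s 0 := by
      apply Complex.ext
      · simp; ring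
      · simp
    rw [e, torusFold_mk, fold_chart_left hn hh s (by simp), AffineMap.lineMap_apply_module]
    have := point_lower (n := n) (h := h) (ρ := ρ) (t := s) (v := 0) (k := 0) le_rfl hsm.1 hsm.2
    simpa using this
  · intro t ht
    have hv : t / slant n h ρ ∈ Set.Icc (0 : ℝ) 1 :=
      ⟨div_nonneg ht.1 hs.le, (div_le_one hs).2 ht.2⟩
    have e : (0 + (((s * side n : ℝ) : ℂ) + t * Complex.I) * 1) =
        chart n h ρ 1 (s - t / slant n h ρ * drift n ρ / side n) (t / slant n h ρ) := by
      apply Complex.ext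
      · simp
        field_simp
        ring
      · simp
        field_simp
    rw [e, torusFold_mk, fold_chart_left hn hh _ hv]
    exact (mem_annulus (by omega)).2 ⟨_, _, hv, rfl⟩

lemma isOrigamiTorusOfModulus_of_lattice_eq (H : Compatible n L ρ) (hh : 0 < h) {ω : ℂ}
    (hω : ω ≠ 0) {τ : UpperHalfPlane} (e : torusLattice ω τ = periods n h ρ L) :
    IsOrigamiTorusOfModulus n h ρ (ρ + L / n) τ := by
  refine ⟨ω, hω, ?_⟩
  rw [e]
  exact ⟨torusFold H.three_le hh, isOrigamiEmbedding_torusFold H hh,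
    range_torusFold H.three_le hh, innerOnLeft_torusFold H.three_le hh⟩

lemma torusLattice_eq_periods {τ : UpperHalfPlane}
    (hτ : (n * side n : ℝ) * (τ : ℂ) = translation n h ρ L) :
    torusLattice ((n * side n : ℝ) : ℂ) τ = periods n h ρ L := by
  rw [torusLattice, periods, hτ]

lemma side_mul_ne_zero (hn : 3 ≤ n) : ((n * side n : ℝ) : ℂ) ≠ 0 := by
  have := side_pos hn
  have hn' : (0 : ℝ) < n := by exact_mod_cast (by omega : 0 < n)
  exact_mod_cast (mul_pos hn' this).ne'

lemma exists_isOrigamiTorusOfModulus (H : Compatible n L ρ) (hh : 0 < h) :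
    ∃ τ : UpperHalfPlane, IsOrigamiTorusOfModulus n h ρ (ρ + L / n) τ := by
  have hn := H.three_le
  have h0 := side_mul_ne_zero hn
  have hpos : 0 < n * side n := mul_pos (by exact_mod_cast (by omega : 0 < n)) (side_pos hn)
  have him : 0 < (((n * side n)⁻¹ : ℝ) * translation n h ρ L).im := by
    rw [Complex.im_ofReal_mul]
    exact mul_pos (inv_pos.2 hpos) (translation_im_pos hh)
  refine ⟨⟨_, him⟩, isOrigamiTorusOfModulus_of_lattice_eq H hh h0 (torusLattice_eq_periods ?_)⟩
  change ((n * side n : ℝ) : ℂ) * (((n * side n)⁻¹ : ℝ) * translation n h ρ L) = _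
  rw [Complex.ofReal_inv, mul_inv_cancel_left₀ h0]

end

/-! ### Changing the basis of the lattice. -/

lemma closure_pair_eq {x y : ℂ} {a b c d : ℤ} (hdet : a * d - b * c = 1) :
    AddSubgroup.closure {x, y} = AddSubgroup.closure {d • x + c • y, b • x + a • y} := by
  apply le_antisymm <;> rw [AddSubgroup.closure_le] <;> rintro z (rfl | rfl)
  · have hm := AddSubgroup.subset_closure (k := {d • z + c • y, b • z + a • y})
    have e : z = a • (d • z + c • y) - c • (b • z + a • y) := by
      have h1 : z = (a * d - b * c) • z := by rw [hdet, one_zsmul]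
      conv_lhs => rw [h1]
      module
    have m := sub_mem (zsmul_mem (hm (Set.mem_insert _ _)) a)
      (zsmul_mem (hm (Set.mem_insert_of_mem _ rfl)) c)
    rwa [← e] at m
  · have hm := AddSubgroup.subset_closure (k := {d • x + c • z, b • x + a • z})
    have e : z = d • (b • x + a • z) - b • (d • x + c • z) := by
      have h1 : z = (a * d - b * c) • z := by rw [hdet, one_zsmul]
      conv_lhs => rw [h1]
      module
    have m := sub_mem (zsmul_mem (hm (Set.mem_insert_of_mem _ rfl)) d)
      (zsmul_mem (hm (Set.mem_insert _ _)) b)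
    rwa [← e] at m
  · exact add_mem (zsmul_mem (AddSubgroup.subset_closure (by simp)) _)
      (zsmul_mem (AddSubgroup.subset_closure (by simp)) _)
  · exact add_mem (zsmul_mem (AddSubgroup.subset_closure (by simp)) _)
      (zsmul_mem (AddSubgroup.subset_closure (by simp)) _)

/-- Equivalent points of the upper half plane are moduli of the same flat tori. -/
lemma IsOrigamiTorusOfModulus.of_smul {n : ℕ} {h ρ σ : ℝ} {τ : UpperHalfPlane}
    (γ : Matrix.SpecialLinearGroup (Fin 2) ℤ) (H : IsOrigamiTorusOfModulus n h ρ σ (γ • τ)) :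
    IsOrigamiTorusOfModulus n h ρ σ τ := by
  obtain ⟨ω, hω, hf⟩ := H
  have hd := UpperHalfPlane.denom_ne_zero γ τ
  -- With `cτ + d` the denominator, the lattice spanned by `1` and `γ • τ` is that spanned by `cτ +
  -- d` and `aτ + b`, divided by `cτ + d`.
  refine ⟨ω / UpperHalfPlane.denom γ τ, div_ne_zero hω hd, ?_⟩
  have e : torusLattice (ω / UpperHalfPlane.denom γ τ) τ = torusLattice ω (γ • τ) := by
    have hdet := γ.det_coe
    rw [Matrix.det_fin_two] at hdet
    rw [torusLattice, torusLattice, closure_pair_eq hdet, UpperHalfPlane.coe_specialLinearGroup_apply]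
    rw [ModularGroup.denom_apply] at hd ⊢
    congr 2
    · simp only [zsmul_eq_mul]
      field_simp
      ring
    · simp only [zsmul_eq_mul, algebraMap_int_eq, eq_intCast, Complex.ofReal_intCast]
      field_simp
      ring_nf
  rw [e]
  exact hf

/-! ### Realising a given modulus. -/

lemma tendsto_mul_sin_div : Tendsto (fun n : ℕ => n * sin (π / n)) atTop (𝓝 π) := by
  have h1 : Tendsto (fun n : ℕ => π * sinc (π / n)) atTop (𝓝 (π * sinc 0)) :=
    ((continuous_sinc.tendsto 0).comp (tendsto_const_div_atTop_nhds_zero_nat π)).const_mul π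
  rw [sinc_zero, mul_one] at h1
  refine h1.congr' ?_
  filter_upwards [eventually_gt_atTop 0] with n hn
  have hn' : (n : ℝ) ≠ 0 := by positivity
  have := pi_ne_zero
  rw [sinc_of_ne_zero (by positivity)]
  field_simp

/-- Every real part is attained, provided it is attained in the limit `n → ∞`, `ℓ / n → t`. -/
lemma exists_angle_of_limit {r t : ℝ} (ht0 : 0 < t) (ht1 : t < 1)
    (hC1 : -cos (π * t) < (t - r) * π / sin (π * t)) (hC2 : (t - r) * π / sin (π * t) < 1) :
    ∃ (n ℓ : ℕ) (φ : ℝ), 5 ≤ n ∧ 2 ≤ ℓ ∧ ℓ + 3 ≤ n ∧ 3 < n * sin (π / n) ∧ π / n < φ ∧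
      φ < π - π * (ℓ + 1) / n ∧
      (ℓ / n : ℝ) - sin (π * ℓ / n) / (n * sin (π / n)) * cos φ = r := by
  have l0 : Tendsto (fun n : ℕ => (1 : ℝ) / n) atTop (𝓝 0) := tendsto_const_div_atTop_nhds_zero_nat 1
  have l1 : Tendsto (fun n : ℕ => (⌊t * n⌋₊ : ℝ) / n) atTop (𝓝 t) :=
    (tendsto_nat_floor_mul_div_atTop ht0.le).comp tendsto_natCast_atTop_atTop
  have l2 := tendsto_mul_sin_div
  have sin_t : 0 < sin (π * t) :=
    sin_pos_of_pos_of_lt_pi (mul_pos pi_pos ht0) (by nlinarith [pi_pos])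
  have l3 : Tendsto (fun n : ℕ => sin (π * ((⌊t * n⌋₊ : ℝ) / n))) atTop (𝓝 (sin (π * t))) :=
    (continuous_sin.tendsto _).comp (l1.const_mul π)
  have l4 := ((l1.sub_const r).mul l2).div l3 sin_t.ne'
  have l5 : Tendsto (fun n : ℕ => cos (π * (1 / n))) atTop (𝓝 1) := by
    have := (continuous_cos.tendsto _).comp (l0.const_mul π)
    simpa [Function.comp_def] using this
  have l6 : Tendsto (fun n : ℕ => -cos (π * ((⌊t * n⌋₊ : ℝ) / n + 1 / n))) atTop
      (𝓝 (-cos (π * t))) := by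
    have := ((continuous_cos.tendsto _).comp ((l1.add l0).const_mul π)).neg
    simpa using this
  have l7 : Tendsto (fun n : ℕ => 2 * ((1 : ℝ) / n)) atTop (𝓝 0) := by simpa using l0.const_mul 2
  have l8 : Tendsto (fun n : ℕ => (⌊t * n⌋₊ : ℝ) / n + 3 * (1 / n)) atTop (𝓝 t) := by
    simpa using l1.add (l0.const_mul 3)
  -- All requirements are strict inequalities in the limit, apart from `5 ≤ n`, so they hold for
  -- some large `n` with `ℓ = ⌊t n⌋`.
  obtain ⟨n, h5, hlow, hupp, hs, hsin, hc1, hc2⟩ := ((eventually_ge_atTop 5).and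
    ((l7.eventually_lt l1 ht0).and ((l8.eventually_lt_const ht1).and
    ((l2.eventually_const_lt pi_gt_three).and ((l3.eventually_const_lt sin_t).and
    ((l6.eventually_lt l4 hC1).and (l4.eventually_lt l5 hC2))))))).exists
  have hn : (5 : ℝ) ≤ n := by exact_mod_cast h5
  have hn0 : (0 : ℝ) < n := by linarith
  set ℓ := ⌊t * n⌋₊
  simp only [Pi.div_apply] at hc1 hc2
  -- The equation for `φ` solved for its cosine; the bounds on `φ` become bounds on `c` since cosine
  -- decreases.
  set c := ((ℓ : ℝ) / n - r) * (n * sin (π / n)) / sin (π * (ℓ / n)) with hc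
  have hℓ2 : (2 : ℝ) < ℓ := by
    rw [mul_one_div, div_lt_div_iff_of_pos_right hn0] at hlow
    exact hlow
  have hℓ3 : (ℓ : ℝ) + 3 < n := by
    rw [mul_one_div, ← add_div, div_lt_one hn0] at hupp
    exact hupp
  have c1 : c ≤ 1 := hc2.le.trans (cos_le_one _)
  have c2 : -1 ≤ c := (neg_le_neg (cos_le_one _)).trans hc1.le
  have b1 : π * (1 / n) ≤ π := by
    apply mul_le_of_le_one_right pi_pos.le
    rw [div_le_one hn0]; linarith
  have b0 : 0 ≤ π * (1 / (n : ℝ)) := by positivity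
  have b2 : 0 ≤ π * ((ℓ : ℝ) / n + 1 / n) := by positivity
  have b3 : π * ((ℓ : ℝ) / n + 1 / n) ≤ π := by
    apply mul_le_of_le_one_right pi_pos.le
    rw [← add_div, div_le_one hn0]; linarith
  refine ⟨n, ℓ, arccos c, h5, by exact_mod_cast hℓ2.le, by exact_mod_cast hℓ3.le, hs, ?_, ?_, ?_⟩
  · have := arccos_lt_arccos c2 hc2 (cos_le_one _)
    rw [arccos_cos b0 b1] at this
    rwa [mul_one_div] at this
  · rw [← cos_pi_sub] at hc1
    have := arccos_lt_arccos (neg_one_le_cos _) hc1 c1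
    rw [arccos_cos (by linarith) (by linarith)] at this
    rw [← add_div, ← mul_div_assoc] at this
    exact this
  · rw [cos_arccos c2 c1, hc, mul_div_assoc π]
    have := hsin.ne'
    have hs0 : sin (π / n) ≠ 0 := by
      intro h0
      rw [h0] at hs
      norm_num at hs
    generalize sin (π * (ℓ / n)) = S at *
    field_simp
    ring

/-- For `r < 1/2` take `t = r`, where the limiting cosine is 0. For `r = 1/2` that choice only gives
equality in the lower bound, and `t = 2/3` is used: the limiting cosine is `π / (3√3)`, strictly
between `1/2` and `1`. -/
lemma exists_angle {r : ℝ} (hr0 : 0 < r) (hr1 : r ≤ 1 / 2) :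
    ∃ (n ℓ : ℕ) (φ : ℝ), 5 ≤ n ∧ 2 ≤ ℓ ∧ ℓ + 3 ≤ n ∧ 3 < n * sin (π / n) ∧ π / n < φ ∧
      φ < π - π * (ℓ + 1) / n ∧
      (ℓ / n : ℝ) - sin (π * ℓ / n) / (n * sin (π / n)) * cos φ = r := by
  have := pi_pos
  rcases hr1.lt_or_eq with hr | rfl
  · refine exists_angle_of_limit (t := r) hr0 (by linarith) ?_ (by simp)
    have : 0 < cos (π * r) := cos_pos_of_mem_Ioo ⟨by nlinarith, by nlinarith⟩
    simpa using this
  · have e1 : cos (π * (2 / 3)) = -(1 / 2) := by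
      rw [show π * (2 / 3) = π - π / 3 by ring, cos_pi_sub, cos_pi_div_three]
    have e2 : sin (π * (2 / 3)) = √3 / 2 := by
      rw [show π * (2 / 3) = π - π / 3 by ring, sin_pi_sub, sin_pi_div_three]
    have s1 : √3 < 1.8 := by rw [sqrt_lt' (by norm_num)]; norm_num
    have s2 : 1.7 < √3 := by rw [lt_sqrt (by norm_num)]; norm_num
    refine exists_angle_of_limit (t := 2 / 3) (by norm_num) (by norm_num) ?_ ?_
    · rw [e1, e2, lt_div_iff₀ (by positivity)]
      linarith [pi_gt_three]
    · rw [e2, div_lt_one (by positivity)]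
      linarith [pi_lt_four]

lemma slant_zero_le (n : ℕ) (ρ : ℝ) : slant n 0 ρ ≤ 2 := by
  rw [slant, sqrt_le_left (by norm_num)]
  have h1 := neg_one_le_cos (π / n)
  have h2 := cos_le_one (π / n)
  have h3 := neg_one_le_cos (2 * π * ρ + π / n)
  have h4 := cos_le_one (2 * π * ρ + π / n)
  nlinarith

lemma le_slant (n : ℕ) (h ρ : ℝ) : h ≤ slant n h ρ := by
  apply le_sqrt_of_sq_le
  nlinarith [sq_nonneg (cos (π / n) - cos (2 * π * ρ + π / n))]

/-- At height 0 the two widths add up to at most 4, and they exceed any bound as the height grows.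
-/
lemma exists_height (n : ℕ) (ρ σ : ℝ) {V : ℝ} (hV : 4 < V) :
    ∃ h, 0 < h ∧ slant n h ρ + slant n h σ = V := by
  have c : Continuous fun h => slant n h ρ + slant n h σ := by
    unfold slant
    fun_prop
  have hlow : slant n 0 ρ + slant n 0 σ < V := by
    linarith [slant_zero_le n ρ, slant_zero_le n σ]
  have hupp : V ≤ slant n V ρ + slant n V σ := by
    linarith [le_slant n V ρ, le_slant n V σ]
  obtain ⟨h, ⟨h0, -⟩, e⟩ := intermediate_value_Icc (by linarith : 0 ≤ V) c.continuousOn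
    ⟨hlow.le, hupp⟩
  refine ⟨h, h0.lt_of_ne ?_, e⟩
  rintro rfl
  exact hlow.ne e

/-- The modulus of the torus in terms of the parameters, by real and imaginary part. -/
lemma isOrigamiTorusOfModulus_of_eq {n : ℕ} {L : ℤ} {h ρ : ℝ} (H : Compatible n L ρ) (hh : 0 < h)
    {τ : UpperHalfPlane} (hre : n * side n * τ.re = drift n ρ - drift n (ρ + L / n) + side n * L)
    (him : n * side n * τ.im = slant n h ρ + slant n h (ρ + L / n)) :
    IsOrigamiTorusOfModulus n h ρ (ρ + L / n) τ := by
  refine isOrigamiTorusOfModulus_of_lattice_eq H hh (side_mul_ne_zero H.three_le)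
    (torusLattice_eq_periods ?_)
  apply Complex.ext
  · rw [Complex.re_ofReal_mul, translation_re, ← hre]; rfl
  · rw [Complex.im_ofReal_mul, translation_im, ← him]; rfl

lemma exists_admissible {τ : UpperHalfPlane} (hτ : τ.re ≠ 0) (hτ' : |τ.re| ≤ 1 / 2)
    (him : 3 ≤ 4 * τ.im ^ 2) :
    ∃ (n ℓ : ℕ) (h ρ σ : ℝ), Admissible n ℓ h ρ σ ∧ IsOrigamiTorusOfModulus n h ρ σ τ := by
  obtain ⟨n, ℓ, φ, h5, h2, h3, hs, hφ1, hφ2, hr⟩ := exists_angle (abs_pos.2 hτ) hτ'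
  have hn : (5 : ℝ) ≤ n := by exact_mod_cast h5
  have hn0 : (0 : ℝ) < n := by linarith
  -- Here `n * side n > 6` and `Im τ ≥ √3/2 > 0.8`.
  have hV : 4 < n * side n * τ.im := by
    have : (0.8 : ℝ) < τ.im := by
      have := τ.im_pos
      by_contra hc
      nlinarith
    rw [side]
    nlinarith
  have hs0 : sin (π / n) ≠ 0 := by
    intro h0
    rw [h0] at hs
    norm_num at hs
  have hπ := pi_pos
  have hr' : n * side n * |τ.re| = side n * ℓ - 2 * sin (π * ℓ / n) * cos φ := by
    rw [← hr, side]
    field_simp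
  have key : ∀ (ρ σ : ℝ) (L : ℤ), (L = ℓ ∨ L = -ℓ) → σ = ρ + L / n →
      ((σ = ρ + (ℓ : ℝ) / n ∧ -(1 / 2) < ρ ∧ ρ < -((ℓ : ℝ) / (2 * n)) - 1 / n) ∨
        (σ = ρ - (ℓ : ℝ) / n ∧ (ℓ : ℝ) / (2 * n) < ρ ∧ ρ < 1 / 2 - 1 / n)) →
      n * side n * τ.re = drift n ρ - drift n σ + side n * L →
      ∃ (n ℓ : ℕ) (h ρ σ : ℝ), Admissible n ℓ h ρ σ ∧ IsOrigamiTorusOfModulus n h ρ σ τ := by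
    intro ρ σ L hL hσ hrange hre
    obtain ⟨h, hh, e⟩ := exists_height n ρ σ hV
    have A : Admissible n ℓ h ρ σ := ⟨h5, hh, h2, h3, hrange⟩
    obtain ⟨L', hL', hσ', H⟩ := A.compatible
    have hLL : L' = L := by
      have : (L' : ℝ) / n = L / n := by linarith
      rw [div_left_inj' hn0.ne'] at this
      exact_mod_cast this
    subst hLL
    subst hσ'
    exact ⟨n, ℓ, h, ρ, _, A, isOrigamiTorusOfModulus_of_eq H hh hre e.symm⟩
  rcases hτ.lt_or_gt with hneg | hpos
  · rw [abs_of_neg hneg] at hr'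
    -- Chosen so that `2πρ + π/n` and `2πσ + π/n` are `φ ± πℓ/n`; the drifts then differ by `2 sin
    -- (πℓ/n) cos φ`, and the bounds on `φ` become the admissible range of `ρ`.
    refine key ((φ + π * ℓ / n - π / n) / (2 * π))
      ((φ + π * ℓ / n - π / n) / (2 * π) - ℓ / n) (-ℓ) (Or.inr rfl) (by push_cast; ring)
      (Or.inr ⟨rfl, ?_, ?_⟩) ?_
    · rw [lt_div_iff₀ (by positivity)]
      have : (ℓ : ℝ) / (2 * n) * (2 * π) = π * ℓ / n := by field_simp
      rw [this]; linarith
    · rw [div_lt_iff₀ (by positivity)]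
      have e1 : (1 / 2 - 1 / (n : ℝ)) * (2 * π) = π - 2 * (π / n) := by field_simp
      have e2 : π * (ℓ + 1) / n = π * ℓ / n + π / n := by ring
      rw [e1]; linarith
    · have e1 : 2 * π * ((φ + π * ℓ / n - π / n) / (2 * π)) + π / n = φ + π * ℓ / n := by
        field_simp
        ring
      have e2 : 2 * π * ((φ + π * ℓ / n - π / n) / (2 * π) - ℓ / n) + π / n = φ - π * ℓ / n := by
        field_simp
        ring
      rw [drift, drift, e1, e2, sin_add, sin_sub]
      push_cast
      linarith
  · rw [abs_of_pos hpos] at hr'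
    -- The mirror image: both angles and `L` change sign.
    refine key (-(φ + π * (ℓ + 1) / n) / (2 * π))
      (-(φ + π * (ℓ + 1) / n) / (2 * π) + ℓ / n) ℓ (Or.inl rfl) (by push_cast; ring)
      (Or.inl ⟨rfl, ?_, ?_⟩) ?_
    · rw [lt_div_iff₀ (by positivity)]
      linarith
    · rw [div_lt_iff₀ (by positivity)]
      have e1 : (-((ℓ : ℝ) / (2 * n)) - 1 / n) * (2 * π) = -(π * ℓ / n) - 2 * (π / n) := by
        field_simp
      have e2 : π * (ℓ + 1) / n = π * ℓ / n + π / n := by ring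
      rw [e1]; linarith
    · have e1 : 2 * π * (-(φ + π * (ℓ + 1) / n) / (2 * π)) + π / n = -(φ + π * ℓ / n) := by
        field_simp
        ring
      have e2 : 2 * π * (-(φ + π * (ℓ + 1) / n) / (2 * π) + ℓ / n) + π / n =
          -(φ - π * ℓ / n) := by
        field_simp
        ring
      rw [drift, drift, e1, e2, sin_neg, sin_neg, sin_add, sin_sub]
      push_cast
      linarith

end OrigamiTorus

end

theorem mainTheorem2 :
    (∀ (n ℓ : ℕ) (h ρ σ : ℝ), OrigamiTorus.Admissible n ℓ h ρ σ →
      OrigamiTorus.annulusBoundary n h ρ = OrigamiTorus.annulusBoundary n h σ ∧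
      OrigamiTorus.annulus n h ρ ∩ OrigamiTorus.annulus n h σ =
        OrigamiTorus.annulusBoundary n h ρ ∧
      ∃ τ : UpperHalfPlane, OrigamiTorus.IsOrigamiTorusOfModulus n h ρ σ τ) ∧
    (∀ τ : UpperHalfPlane, (∀ γ : SL(2, ℤ), (γ • τ).re ≠ 0) →
      ∃ (n ℓ : ℕ) (h ρ σ : ℝ), OrigamiTorus.Admissible n ℓ h ρ σ ∧
        OrigamiTorus.IsOrigamiTorusOfModulus n h ρ σ τ) := by
  constructor
  · intro n ℓ h ρ σ A
    have hh := A.height_pos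
    obtain ⟨L, -, rfl, H⟩ := A.compatible
    have hn := H.three_le
    exact ⟨OrigamiTorus.annulusBoundary_add (by omega) h ρ L, H.annulus_inter hh,
      OrigamiTorus.exists_isOrigamiTorusOfModulus H hh⟩
  · intro τ hτ
    -- The hypothesis on the orbit ensures that the representative in the fundamental domain has
    -- nonzero real part.
    obtain ⟨γ, hγ⟩ := ModularGroup.exists_smul_mem_fd τ
    obtain ⟨n, ℓ, h, ρ, σ, A, H⟩ := OrigamiTorus.exists_admissible (hτ γ) hγ.2
      (ModularGroup.three_le_four_mul_im_sq_of_mem_fd hγ)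
    exact ⟨n, ℓ, h, ρ, σ, A, H.of_smul γ⟩
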